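/- Write $(a;q)_n=\prod_{i=1}^{n}(1-aq^{i-1})$, $(a)_n=(a;q)_n$, $(a;q)_\infty=\prod_{i\ge1}(1-aq^{i-1})$, $(a)_\infty=(a;q)_\infty$. For a partition $\lambda$ let $l(\lambda)$ be its number of positive parts, $|\lambda|$ the sum of its parts, $\lambda'$ its conjugate, $2\lambda$ the partition with parts $2\lambda_i$, $m_i(\lambda)$ the multiplicity of the part $i$, $n(\lambda)=\sum_i\binom{\lambda_i}{2}$, and $(a;q)_\lambda=\prod_{i\ge1}(a;q)_{\lambda_i-\lambda_{i+1}}$. Put $$\begin{bmatrix}n\\ \lambda\end{bmatrix}=\frac{(q)_n}{(q)_{n-\lambda_1}(q)_\lambda}\ \ (=0\text{ if }\lambda_1>n),\qquad \begin{bmatrix}n\\ r\end{bmatrix}=\frac{(q)_n}{(q)_{n-r}(q)_r}\ \ (=0\text{ if }r>n),$$ $$c_{\lambda,k}(q)=\prod_{i=1}^{k-1}(q;q^2)_{m_i(\lambda)/2}\ \ (\text{all } m_i(\lambda)\text{ even}),\qquad d_{\lambda,k}(q)=\prod_{i=1}^{k-1}\frac{(q)_{m_i(\lambda)}}{(q^2;q^2)_{\lfloor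 m_i(\lambda)/2\rfloor}} .$$ **Theorem 4.** Let $k\ge1$. (a) For every $n\ge 0$, the following hold as identities of rational functions in $q,z$; more precisely, each holds for all $q\neq 0$ and $z$ in any field for which the denominators occurring in it are nonzero (that is, $(q)_n\ne0$ and, for all $r\ge 0$ with $2r\le n$, respectively $r\le n$, the displayed denominators in the $r$-th summand on the right are nonzero): $$\sum_{l(\lambda)\le k}c_{(2\lambda)',k}(q)\,z^{|\lambda|}q^{n(2\lambda)}\begin{bmatrix}n\\2\lambda\end{bmatrix}=(z;q^2)_n\sum_{r\ge0}z^{kr}q^{(k+1)\binom{2r}{2}}\begin{bmatrix}n\\2r\end{bmatrix}\frac{1-zq^{4r-1}}{(zq^{2r-1})_{n+1}},$$ $$\sum_{l(\lambda)\le k}d_{\lambda',k}(q)\,z^{|\lambda|}q^{n(\lambda)}\begin{bmatrix}n\\\lambda\end{bmatrix}=(z^2;q^2)_n\sum_{r\ge0}z^{kr}q^{r+(k+1)\binom r2}\begin{bmatrix}n\\r\end{bmatrix}\frac{(1-zq^{-1})(1-z^2q^{2r-1})(1-zq^n)}{(1-zq^{r-1})(1-zq^r)(z^2q^{r-1})_{n+1}}.$$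 All these sums have only finitely many nonzero terms. (b) Let $q,z\in\mathbb C$ with $0<|q|<1$ and $zq^{m}\ne1$ for all integers $m\ge-1$. Then, as $n\to\infty$, the left and right sides of the first identity in (a) converge respectively to the left and right sides of $$\sum_{l(\lambda)\le k}\frac{z^{|\lambda|}q^{n(2\lambda)}}{(q^2;q^2)_\lambda\,(q;q^2)_{\lambda_k}}=(z;q^2)_\infty\sum_{r\ge0}\frac{z^{kr}q^{(k+1)\binom{2r}2}}{(q)_{2r}(zq^{2r-1})_\infty}(1-zq^{4r-1}),$$ and this identity holds, with both series absolutely convergent. If moreover $z^2q^m\neq1$ for all integers $m\ge-1$, then the left and right sides of the second identity in (a) converge respectively to the left and right sides of $$\sum_{l(\lambda)\le k}\frac{z^{|\lambda|}q^{n(\lambda)}}{(q)_{\lambda_k}\prod_{i=1}^{k-1}(q^2;q^2)_{\lfloor(\lambda_i-\lambda_{i+1})/2\rfloor}}=(z^2;q^2)_\infty\sum_{r\ge0}z^{kr}q^{r+(k+1)\binom r2}\frac{1-zq^{-1}}{(q)_r(1-zq^{r-1})}\cdot\frac{1-z^2q^{2r-1}}{(1-zq^r)(z^2q^{r-1})_\infty},$$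 and this identity holds, with both series absolutely convergent. -/

import Mathlib

open Filter Topology

universe u

/-!
Partitions are Mathlib's Young diagrams `μ`: the part `λ_i` (`i ≥ 1`) is `μ.rowLen (i - 1)`, the
length `l(λ)` is `μ.colLen 0`, the weight `|λ|` is `μ.card`, the list of the positive parts is
`μ.rowLens`, and the conjugate `λ'` is `μ.transpose`.
-/

namespace QPart

/-- The part `λ_i` of a partition, with indices starting from `1`. -/
def part (μ : YoungDiagram) (i : ℕ) : ℕ := μ.rowLen (i - 1)

/-- The multiplicity `m_i(λ)` of `i` (`i ≥ 1`) among the parts of a partition. -/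
def mult (μ : YoungDiagram) (i : ℕ) : ℕ := μ.rowLens.count i

/-- The partition `2λ`, all of whose parts are twice those of `λ`. -/
def double (μ : YoungDiagram) : YoungDiagram :=
  YoungDiagram.ofRowLens (μ.rowLens.map (fun x => 2 * x))
    (List.pairwise_map.2 (μ.rowLens_sorted.pairwise.imp
      (fun h => Nat.mul_le_mul_left 2 h))).sortedGE

/-- The set of partitions with at most `k` positive parts, `l(λ) ≤ k`. -/
def lengthLE (k : ℕ) : Set YoungDiagram := {μ | μ.colLen 0 ≤ k}

/-- The statistic `n(λ) = ∑ᵢ (λᵢ choose 2)`. -/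
def nStat (μ : YoungDiagram) : ℕ := (μ.rowLens.map (fun x => x.choose 2)).sum

section Field

variable {K : Type*} [Field K]

/-- The finite `q`-shifted factorial `(a; q)_n = ∏_{i=1}^{n} (1 - a q^{i-1})`. -/
def poch (a q : K) (n : ℕ) : K := ∏ i ∈ Finset.range n, (1 - a * q ^ i)

/-- `(a; q)_λ = (a; q)_{λ_1 - λ_2} (a; q)_{λ_2 - λ_3} ⋯`. -/
def pochPart (a q : K) (μ : YoungDiagram) : K :=
  ∏ i ∈ Finset.Icc 1 (μ.colLen 0), poch a q (part μ i - part μ (i + 1))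

/-- The `q`-binomial coefficient of `n` and `r`, zero if `r > n`. -/
def qBinom (q : K) (n r : ℕ) : K :=
  if r ≤ n then poch q q n / (poch q q (n - r) * poch q q r) else 0

/-- The generalized `q`-binomial coefficient of `n` and `λ`, that is
`(q)_n / ((q)_{n - λ_1} (q)_λ)`, zero if `λ_1 > n`. -/
def qBinomPart (q : K) (n : ℕ) (μ : YoungDiagram) : K :=
  if part μ 1 ≤ n then poch q q n / (poch q q (n - part μ 1) * pochPart q q μ) else 0

/-- `c_{λ,k}(q) = ∏_{i=1}^{k-1} (q; q²)_{m_i(λ)/2}`, used when all `m_i(λ)` are even. -/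
def cCoeff (q : K) (k : ℕ) (μ : YoungDiagram) : K :=
  ∏ i ∈ Finset.Icc 1 (k - 1), poch q (q ^ 2) (mult μ i / 2)

/-- `d_{λ,k}(q) = ∏_{i=1}^{k-1} (q; q)_{m_i(λ)} / (q²; q²)_{⌊m_i(λ)/2⌋}`. -/
def dCoeff (q : K) (k : ℕ) (μ : YoungDiagram) : K :=
  ∏ i ∈ Finset.Icc 1 (k - 1),
    poch q q (mult μ i) / poch (q ^ 2) (q ^ 2) (mult μ i / 2)

/-- The `λ`-term of the sum with the coefficients `c_{(2λ)',k}`. -/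
def cTerm (k n : ℕ) (q z : K) (μ : YoungDiagram) : K :=
  cCoeff q k (double μ).transpose * z ^ μ.card * q ^ nStat (double μ) * qBinomPart q n (double μ)

/-- The `λ`-term of the sum with the coefficients `d_{λ',k}`. -/
def dTerm (k n : ℕ) (q z : K) (μ : YoungDiagram) : K :=
  dCoeff q k μ.transpose * z ^ μ.card * q ^ nStat μ * qBinomPart q n μ

/-- The closed form for the `c`-sum; the terms with `2r > n` vanish. -/
def cClosed (k n : ℕ) (q z : K) : K :=
  poch z (q ^ 2) n * ∑ r ∈ Finset.range (n + 1),
    z ^ (k * r) * q ^ ((k + 1) * (2 * r).choose 2) * qBinom q n (2 * r) *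
      ((1 - z * q ^ (4 * (r : ℤ) - 1)) / poch (z * q ^ (2 * (r : ℤ) - 1)) q (n + 1))

/-- The closed form for the `d`-sum; the terms with `r > n` vanish. -/
def dClosed (k n : ℕ) (q z : K) : K :=
  poch (z ^ 2) (q ^ 2) n * ∑ r ∈ Finset.range (n + 1),
    z ^ (k * r) * q ^ (r + (k + 1) * r.choose 2) * qBinom q n r *
      (((1 - z * q ^ (-1 : ℤ)) * (1 - z ^ 2 * q ^ (2 * (r : ℤ) - 1)) * (1 - z * q ^ n)) /
        ((1 - z * q ^ ((r : ℤ) - 1)) * (1 - z * q ^ r) *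
          poch (z ^ 2 * q ^ ((r : ℤ) - 1)) q (n + 1)))

end Field

/-- The infinite `q`-shifted factorial `(a; q)_∞`, for complex `|q| < 1`. -/
noncomputable def pochInf (a q : ℂ) : ℂ := ∏' i : ℕ, (1 - a * q ^ i)

/-- The `λ`-term of the limiting `c`-sum. -/
noncomputable def cLimTerm (k : ℕ) (q z : ℂ) (μ : YoungDiagram) : ℂ :=
  z ^ μ.card * q ^ nStat (double μ) /
    (pochPart (q ^ 2) (q ^ 2) μ * poch q (q ^ 2) (part μ k))

/-- The `λ`-term of the limiting `d`-sum. -/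
noncomputable def dLimTerm (k : ℕ) (q z : ℂ) (μ : YoungDiagram) : ℂ :=
  z ^ μ.card * q ^ nStat μ /
    (poch q q (part μ k) *
      ∏ i ∈ Finset.Icc 1 (k - 1), poch (q ^ 2) (q ^ 2) ((part μ i - part μ (i + 1)) / 2))

/-- The `r`-th term of the series in the limiting closed form of the `c`-sum. -/
noncomputable def cLimClosedTerm (k : ℕ) (q z : ℂ) (r : ℕ) : ℂ :=
  z ^ (k * r) * q ^ ((k + 1) * (2 * r).choose 2) /
    (poch q q (2 * r) * pochInf (z * q ^ (2 * (r : ℤ) - 1)) q) *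
      (1 - z * q ^ (4 * (r : ℤ) - 1))

/-- The `r`-th term of the series in the limiting closed form of the `d`-sum. -/
noncomputable def dLimClosedTerm (k : ℕ) (q z : ℂ) (r : ℕ) : ℂ :=
  z ^ (k * r) * q ^ (r + (k + 1) * r.choose 2) *
    ((1 - z * q ^ (-1 : ℤ)) / (poch q q r * (1 - z * q ^ ((r : ℤ) - 1)))) *
    ((1 - z ^ 2 * q ^ (2 * (r : ℤ) - 1)) /
      ((1 - z * q ^ r) * pochInf (z ^ 2 * q ^ ((r : ℤ) - 1)) q))

end QPart

/-! Write k = s + 1. After cancellation the term of a partition λ factors along consecutive parts: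
it is (q)_n / (q)_{n-2λ_1} (for the c-sum) or (q)_n / (q)_{n-λ_1} (for the d-sum), times ∏ D(λ_i)
over i ≤ k, times ∏ κ(λ_i - λ_{i+1}) over i < k, times v(λ_k). Here κ(N) is 1/(q²;q²)_N,
respectively 1/(q²;q²)_{⌊N/2⌋}; D(j) is z^j q^{binom(2j,2)}, respectively z^j q^{binom(j,2)}; and
v(j) is 1/(q)_{2j}, respectively 1/(q)_j. Summing over λ therefore applies the matrix T(m,j) =
κ(m-j) D(j) to v exactly k - 1 times and then pairs the result with a last weight.

T is lower triangular with diagonal D(r), and it is diagonalized explicitly. With t = z/q, the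
eigenvector for D(r) is the column r of the Bailey matrix in base q² relative to t
(`evenKernel_eigen`), respectively a variant depending on the parity of m - r
(`parityKernel_eigen`). Both eigenvalue equations come from one q-Vandermonde sum,
`sum_vandermonde`. The vector v is expanded in eigenvectors by `sum_evenCoeff` and
`sum_parityCoeff`, and the last pairing of each eigenvector is evaluated by the q-Gauss sum
`sum_gauss`. Each application of T multiplies the r-th coefficient by D(r), and the last pairing
gives one more such factor (`sum_chain_eigen`); D(r)^k accounts for the powers of z and for all but
one of the k + 1 copies of the binomial exponent, the coefficient supplying the rest.

The four underlying summations are proved by induction through first-order recurrences whose partial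
sums have closed forms. The limit n → ∞ is dominated convergence on both sides. The limits then
agree because the two sides agree for every n. -/

namespace QPart

/-! ### Finite q-shifted factorials and their truncated reciprocals -/

section FiniteIdentities

variable {K : Type*} [Field K]

@[simp] theorem poch_zero (a q : K) : poch a q 0 = 1 := by simp [poch]

theorem poch_succ (a q : K) (n : ℕ) : poch a q (n + 1) = poch a q n * (1 - a * q ^ n) := by
  simp [poch, Finset.prod_range_succ]

theorem poch_add (a q : K) (m n : ℕ) :
    poch a q (m + n) = poch a q m * poch (a * q ^ m) q n := by
  simp only [poch, Finset.prod_range_add]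
  congr 1
  exact Finset.prod_congr rfl fun i _ => by ring

theorem poch_ne_zero_iff {a q : K} {n : ℕ} :
    poch a q n ≠ 0 ↔ ∀ i < n, 1 - a * q ^ i ≠ 0 := by
  simp [poch, Finset.prod_ne_zero_iff]

theorem poch_ne_zero_of_le {a q : K} {m n : ℕ} (h : poch a q n ≠ 0) (hmn : m ≤ n) :
    poch a q m ≠ 0 :=
  poch_ne_zero_iff.2 fun i hi => poch_ne_zero_iff.1 h i (hi.trans_le hmn)

theorem poch_two_mul (a q : K) (n : ℕ) :
    poch a q (2 * n) = poch a (q ^ 2) n * poch (a * q) (q ^ 2) n := by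
  induction n with
  | zero => simp
  | succ n ih =>
    rw [show 2 * (n + 1) = 2 * n + 1 + 1 by ring, poch_succ, poch_succ, ih, poch_succ, poch_succ]
    ring

/-- The reciprocal `1 / (q)_{n - l}`, read as zero for `l > n`. -/
def recipPoch (q : K) (n l : ℕ) : K := if l ≤ n then (poch q q (n - l))⁻¹ else 0

theorem recipPoch_of_le (q : K) {n l : ℕ} (h : l ≤ n) :
    recipPoch q n l = (poch q q (n - l))⁻¹ := if_pos h

theorem recipPoch_of_lt (q : K) {n l : ℕ} (h : n < l) : recipPoch q n l = 0 :=
  if_neg (not_le.2 h)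

theorem recipPoch_succ_succ (q : K) (n l : ℕ) :
    recipPoch q (n + 1) (l + 1) = recipPoch q n l := by
  simp [recipPoch]

theorem recipPoch_self (q : K) (n : ℕ) : recipPoch q n n = 1 := by
  simp [recipPoch]

theorem recipPoch_add (q : K) (n l : ℕ) : recipPoch q (n + l) l = (poch q q n)⁻¹ := by
  simp [recipPoch]

/-- From (q)_{n+1-l} = (q)_{n-l} (1 - q^{n+1-l}). The factor q^l avoids subtraction in exponents; at
l = n + 1 both sides vanish, so no bound on l is needed. -/
theorem recipPoch_succ_left {q : K} {n : ℕ} (hq : poch q q (n + 1) ≠ 0) (l : ℕ) :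
    (q ^ l - q ^ (n + 1)) * recipPoch q (n + 1) l = q ^ l * recipPoch q n l := by
  rcases lt_trichotomy l (n + 1) with h | h | h
  · obtain ⟨m, rfl⟩ : ∃ m, n = m + l := ⟨n - l, by omega⟩
    have h1 : 1 - q * q ^ m ≠ 0 := poch_ne_zero_iff.1 hq m (by omega)
    have h2 : poch q q m ≠ 0 := poch_ne_zero_of_le hq (by omega)
    rw [recipPoch_add, show m + l + 1 = (m + 1) + l by ring, recipPoch_add, poch_succ]
    field_simp
    ring
  · subst h
    rw [recipPoch_of_lt q (Nat.lt_succ_self n)]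
    ring
  · rw [recipPoch_of_lt q h, recipPoch_of_lt q (by omega)]
    ring

theorem qBinom_eq (q : K) (n r : ℕ) :
    qBinom q n r = poch q q n * recipPoch q n r * (poch q q r)⁻¹ := by
  unfold qBinom recipPoch
  split_ifs
  · rw [div_eq_mul_inv, mul_inv]; ring
  · simp

/-! ### The q-Vandermonde sum -/

/-- The summand of the `q`-Vandermonde sum. -/
def vandermondeTerm (b p : K) (i l : ℕ) : K :=
  b ^ l * p ^ (2 * l.choose 2) * recipPoch p i l / (poch p p l * poch b p l)

theorem two_mul_choose_two_succ (l : ℕ) : 2 * (l + 1).choose 2 = 2 * l.choose 2 + 2 * l := by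
  rw [Nat.choose_succ_succ' l 1, Nat.choose_one_right]; ring

/-- Telescoping certificate for (1 - p^{i+1})(1 - b p^i) S(i+1) = S(i), where S(i) is the full sum.
The right side vanishes at L = i + 1 because `recipPoch` does. -/
theorem vandermonde_partial {b p : K} {i : ℕ} (hp0 : p ≠ 0) (hp : poch p p (i + 1) ≠ 0)
    (hb : poch b p (i + 1) ≠ 0) (L : ℕ) (hL : L ≤ i + 1) :
    ∑ l ∈ Finset.range (L + 1), ((1 - p ^ (i + 1)) * (1 - b * p ^ i) *
      vandermondeTerm b p (i + 1) l - vandermondeTerm b p i l) =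
      - b * p ^ (i + L) * vandermondeTerm b p i L := by
  induction L with
  | zero =>
    have h0 := recipPoch_succ_left hp 0
    simp only [pow_zero, one_mul] at h0
    simp only [zero_add, Finset.range_one, Finset.sum_singleton, vandermondeTerm, pow_zero,
      poch_zero, Nat.choose_zero_succ, mul_zero, mul_one, add_zero, div_one, one_mul]
    linear_combination (1 - b * p ^ i) * h0
  | succ L ih =>
    rw [Finset.sum_range_succ, ih (by omega)]
    have h1 := recipPoch_succ_left hp (L + 1)
    have h2 := recipPoch_succ_succ p i L
    have e1 : (1 - p * p ^ L) ≠ 0 := poch_ne_zero_iff.1 hp L (by omega)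
    have e2 : (1 - b * p ^ L) ≠ 0 := poch_ne_zero_iff.1 hb L (by omega)
    have e3 : poch p p L ≠ 0 := poch_ne_zero_of_le hp (by omega)
    have e4 : poch b p L ≠ 0 := poch_ne_zero_of_le hb (by omega)
    have h3 : (1 - p * p ^ L) * (1 - b * p ^ L) * vandermondeTerm b p (i + 1) (L + 1) =
        b * p ^ (2 * L) * vandermondeTerm b p i L := by
      simp only [vandermondeTerm, poch_succ, two_mul_choose_two_succ, h2]
      generalize 1 - p * p ^ L = e at *
      generalize 1 - b * p ^ L = f at *
      field_simp
      ring
    have h4 : (p ^ (L + 1) - p ^ (i + 1)) * vandermondeTerm b p (i + 1) (L + 1) =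
        p ^ (L + 1) * vandermondeTerm b p i (L + 1) := by
      simp only [vandermondeTerm]
      linear_combination (b ^ (L + 1) * p ^ (2 * (L + 1).choose 2) /
        (poch p p (L + 1) * poch b p (L + 1))) * h1
    have hx : p ^ L ≠ 0 := pow_ne_zero _ hp0
    -- `h4` carries p^{L+1} in front of the new term at i, so the goal is a combination of `h3` and
    -- `h4` only after this multiplication.
    apply mul_left_cancel₀ (mul_ne_zero hp0 hx)
    simp only [pow_add, pow_one, pow_mul'] at h3 h4 ⊢
    generalize vandermondeTerm b p (i + 1) (L + 1) = A at *
    generalize vandermondeTerm b p i (L + 1) = B at *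
    generalize vandermondeTerm b p i L = C at *
    linear_combination (p * p ^ i) * h3 + (1 - b * p * p ^ i * p ^ L) * h4

theorem sum_vandermonde {b p : K} (hp0 : p ≠ 0) (i : ℕ) (hp : poch p p i ≠ 0)
    (hb : poch b p i ≠ 0) :
    ∑ l ∈ Finset.range (i + 1), vandermondeTerm b p i l = (poch p p i * poch b p i)⁻¹ := by
  induction i with
  | zero => simp [vandermondeTerm, recipPoch]
  | succ i ih =>
    have h := vandermonde_partial hp0 hp hb (i + 1) le_rfl
    have h0 : vandermondeTerm b p i (i + 1) = 0 := by
      simp [vandermondeTerm, recipPoch_of_lt]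
    have ih' := ih (poch_ne_zero_of_le hp (by omega)) (poch_ne_zero_of_le hb (by omega))
    rw [Finset.sum_sub_distrib, ← Finset.mul_sum, h0, mul_zero,
      Finset.sum_range_succ (fun l => vandermondeTerm b p i l), h0, add_zero, ih'] at h
    have e1 : (1 - p * p ^ i) ≠ 0 := poch_ne_zero_iff.1 hp i (by omega)
    have e2 : (1 - b * p ^ i) ≠ 0 := poch_ne_zero_iff.1 hb i (by omega)
    rw [sub_eq_zero] at h
    rw [poch_succ, poch_succ]
    rw [← pow_succ'] at e1 ⊢
    rw [mul_mul_mul_comm, mul_inv, ← h]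
    field_simp

/-! ### The q-Gauss sum in base q² -/

/-- The summand of the `q`-Gauss sum in base `q²`. -/
def gaussTerm (u q : K) (N l : ℕ) : K :=
  u ^ l * q ^ (2 * l).choose 2 * recipPoch q N (2 * l) /
    (poch (q ^ 2) (q ^ 2) l * poch (u * q) (q ^ 2) l)

theorem choose_two_two_mul (l : ℕ) : (2 * l).choose 2 = l + 2 * (2 * l.choose 2) := by
  induction l with
  | zero => rfl
  | succ l ih =>
    rw [show 2 * (l + 1) = 2 * l + 1 + 1 by ring, Nat.choose_succ_succ' _ 1,
      Nat.choose_succ_succ' _ 1, ih, two_mul_choose_two_succ]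
    simp; ring

theorem choose_two_two_mul_succ (l : ℕ) :
    (2 * (l + 1)).choose 2 = (2 * l).choose 2 + (4 * l + 1) := by
  rw [choose_two_two_mul, choose_two_two_mul, two_mul_choose_two_succ]; ring

/-- Telescoping certificate for (1 - q^{N+1})(1 - u q^N) S(N+1) = (1 - u q^{2N}) S(N). -/
theorem gauss_partial {u q : K} {N : ℕ} (hq0 : q ≠ 0) (hq : poch q q (N + 1) ≠ 0) (L : ℕ)
    (hp : poch (q ^ 2) (q ^ 2) L ≠ 0) (hu : poch (u * q) (q ^ 2) L ≠ 0) :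
    ∑ l ∈ Finset.range (L + 1), ((1 - q ^ (N + 1)) * (1 - u * q ^ N) *
      gaussTerm u q (N + 1) l - (1 - u * q ^ (2 * N)) * gaussTerm u q N l) =
      - u * q ^ N * (q ^ (2 * L) - q ^ N) * gaussTerm u q N L := by
  induction L with
  | zero =>
    have h0 := recipPoch_succ_left hq 0
    simp only [pow_zero, one_mul] at h0
    simp only [zero_add, Finset.range_one, Finset.sum_singleton, gaussTerm, pow_zero,
      poch_zero, Nat.choose_zero_succ, mul_zero, mul_one, div_one, one_mul]
    linear_combination (1 - u * q ^ N) * h0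
  | succ L ih =>
    have e1 : (1 - q ^ 2 * (q ^ 2) ^ L) ≠ 0 := poch_ne_zero_iff.1 hp L (by omega)
    have e2 : (1 - u * q * (q ^ 2) ^ L) ≠ 0 := poch_ne_zero_iff.1 hu L (by omega)
    have e3 : poch (q ^ 2) (q ^ 2) L ≠ 0 := poch_ne_zero_of_le hp (by omega)
    have e4 : poch (u * q) (q ^ 2) L ≠ 0 := poch_ne_zero_of_le hu (by omega)
    rw [Finset.sum_range_succ, ih e3 e4]
    have h1 := recipPoch_succ_left hq (2 * L + 2)
    have h2 := recipPoch_succ_succ q N (2 * L + 1)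
    have h6 : (q ^ (2 * L) - q ^ N) * recipPoch q N (2 * L) =
        q ^ (2 * L) * recipPoch q N (2 * L + 1) := by
      rw [← recipPoch_succ_succ q N (2 * L)]
      have := recipPoch_succ_left hq (2 * L + 1)
      apply mul_left_cancel₀ hq0
      linear_combination this
    have h3 : (1 - q ^ 2 * (q ^ 2) ^ L) * (1 - u * q * (q ^ 2) ^ L) *
        gaussTerm u q (N + 1) (L + 1) * q ^ (2 * L) =
        u * q ^ (4 * L + 1) * (q ^ (2 * L) - q ^ N) * gaussTerm u q N L := by
      simp only [gaussTerm, poch_succ, choose_two_two_mul_succ]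
      rw [show 2 * (L + 1) = 2 * L + 1 + 1 by ring, h2]
      generalize 1 - q ^ 2 * (q ^ 2) ^ L = e at *
      generalize 1 - u * q * (q ^ 2) ^ L = f at *
      generalize poch (q ^ 2) (q ^ 2) L = e' at *
      generalize poch (u * q) (q ^ 2) L = f' at *
      field_simp
      linear_combination (-u * u ^ L * q * q ^ (2 * L).choose 2 * q ^ (L * 4)) * h6
    have h4 : (q ^ (2 * L + 2) - q ^ (N + 1)) * gaussTerm u q (N + 1) (L + 1) =
        q ^ (2 * L + 2) * gaussTerm u q N (L + 1) := by
      simp only [gaussTerm]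
      rw [show 2 * (L + 1) = 2 * L + 2 by ring]
      linear_combination (u ^ (L + 1) * q ^ (2 * L + 2).choose 2 /
        (poch (q ^ 2) (q ^ 2) (L + 1) * poch (u * q) (q ^ 2) (L + 1))) * h1
    have hx : q ^ L ≠ 0 := pow_ne_zero _ hq0
    apply mul_left_cancel₀ (mul_ne_zero (pow_ne_zero 2 hq0) (pow_ne_zero 4 hx))
    rw [show 2 * (L + 1) = 2 * L + 2 by ring]
    rw [show q ^ (2 * L + 2) = (q ^ L) ^ 2 * q ^ 2 by ring] at *
    rw [show q ^ (2 * L) = (q ^ L) ^ 2 by ring] at *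
    rw [show q ^ (4 * L + 1) = (q ^ L) ^ 4 * q by ring] at *
    rw [show q ^ (2 * N) = (q ^ N) ^ 2 by ring] at *
    rw [show (q ^ 2) ^ L = (q ^ L) ^ 2 by ring] at *
    rw [show q ^ (N + 1) = q ^ N * q by ring] at *
    generalize gaussTerm u q (N + 1) (L + 1) = A at *
    generalize gaussTerm u q N (L + 1) = B at *
    generalize gaussTerm u q N L = C at *
    generalize q ^ L = x at *
    generalize q ^ N = y at *
    linear_combination (y * q) * h3 + x ^ 2 * (1 - u * y * x ^ 2 * q ^ 2) * h4

/-- The upper limit L is independent of N, so the induction on N never changes the range; N ≤ 2L + 1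
ensures that every nonzero term is included. -/
theorem sum_gauss {u q : K} (hq0 : q ≠ 0) (L : ℕ) (hp : poch (q ^ 2) (q ^ 2) L ≠ 0)
    (hu : poch (u * q) (q ^ 2) L ≠ 0) (N : ℕ) (hN : N ≤ 2 * L + 1) (hq : poch q q N ≠ 0)
    (hu' : poch u q N ≠ 0) :
    ∑ l ∈ Finset.range (L + 1), gaussTerm u q N l =
      poch u (q ^ 2) N / (poch q q N * poch u q N) := by
  induction N with
  | zero =>
    rw [Finset.sum_range_succ']
    simp [gaussTerm, recipPoch]
  | succ N ih =>
    have h := gauss_partial hq0 hq L hp hu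
    -- The boundary term dies for two different reasons: for N < 2L the truncated reciprocal is
    -- zero, and for N = 2L the prefactor is.
    have h0 : (q ^ (2 * L) - q ^ N) * gaussTerm u q N L = 0 := by
      rcases (show N ≤ 2 * L by omega).lt_or_eq with h' | h'
      · simp [gaussTerm, recipPoch_of_lt q h']
      · simp [h']
    have ih' := ih (by omega) (poch_ne_zero_of_le hq (by omega))
      (poch_ne_zero_of_le hu' (by omega))
    rw [Finset.sum_sub_distrib, ← Finset.mul_sum, ← Finset.mul_sum,
      mul_assoc _ (q ^ (2 * L) - q ^ N), h0, mul_zero, ih', sub_eq_zero] at h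
    have e1 : (1 - q * q ^ N) ≠ 0 := poch_ne_zero_iff.1 hq N (by omega)
    have e2 : (1 - u * q ^ N) ≠ 0 := poch_ne_zero_iff.1 hu' N (by omega)
    have e3 := poch_ne_zero_of_le hq (Nat.le_succ N)
    have e4 := poch_ne_zero_of_le hu' (Nat.le_succ N)
    rw [poch_succ, poch_succ, poch_succ]
    rw [← pow_succ'] at e1 ⊢
    apply mul_left_cancel₀ (mul_ne_zero e1 e2)
    rw [h, ← pow_mul]
    generalize 1 - q ^ (N + 1) = e at *
    generalize 1 - u * q ^ N = f at *
    field_simp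

/-! ### Expansion of 1/(q)_{2m} in the Bailey matrix -/

/-- The coefficient of the very-well-poised expansion of `1 / (q)_{2m}`. -/
def evenCoeff (t q : K) (r : ℕ) : K :=
  q ^ (2 * r).choose 2 * (poch t q (2 * r) / poch q q (2 * r)) * (1 - t * q ^ (4 * r)) / (1 - t)

/-- The Bailey matrix in base `q²` relative to `t`. -/
def evenKernel (t q : K) (m r : ℕ) : K :=
  recipPoch (q ^ 2) m r / poch (t * q ^ 2) (q ^ 2) (m + r)

/-- Telescoping certificate for (1 - q^{2m+1})(1 - q^{2m+2}) S(m+1) = S(m), the recurrence satisfied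
by 1/(q)_{2m}. -/
theorem evenCoeff_partial {t q : K} {m : ℕ} (hq0 : q ≠ 0) (ht : 1 - t ≠ 0)
    (hq : poch q q (2 * (m + 1)) ≠ 0) (hp : poch (q ^ 2) (q ^ 2) (m + 1) ≠ 0)
    (hb : poch (t * q ^ 2) (q ^ 2) (2 * (m + 1)) ≠ 0) (L : ℕ) (hL : L ≤ m + 1) :
    ∑ r ∈ Finset.range (L + 1), ((1 - q ^ (2 * m + 1)) * (1 - q ^ (2 * m + 2)) *
      (evenCoeff t q r * evenKernel t q (m + 1) r) - evenCoeff t q r * evenKernel t q m r) =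
      - q ^ (2 * m + 1 + 2 * L) * (1 - t * q ^ (2 * L)) * (1 - t * q ^ (2 * L + 1)) *
        (q ^ (2 * L).choose 2 * (poch t q (2 * L) / poch q q (2 * L))) / (1 - t) *
        (recipPoch (q ^ 2) m L / poch (t * q ^ 2) (q ^ 2) (m + L + 1)) := by
  induction L with
  | zero =>
    have h0 := recipPoch_succ_left hp 0
    have e1 : 1 - t * q ^ 2 * (q ^ 2) ^ m ≠ 0 := poch_ne_zero_iff.1 hb m (by omega)
    have e2 := poch_ne_zero_of_le hb (show m ≤ 2 * (m + 1) by omega)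
    simp only [pow_zero, one_mul] at h0
    simp only [zero_add, Finset.range_one, Finset.sum_singleton, pow_zero, evenCoeff, evenKernel,
      poch_zero, Nat.choose_zero_succ, mul_zero, mul_one, add_zero, div_one, one_mul, div_self ht,
      poch_succ]
    rw [← h0]
    have h1 : q ^ (2 * m + 2) = (q ^ 2) ^ (m + 1) := by ring
    have h2 : q ^ (2 * m + 1) = (q ^ 2) ^ m * q := by ring
    rw [h1, h2]
    rw [show (q ^ 2) ^ (m + 1) = (q ^ 2) ^ m * q ^ 2 by ring]
    generalize hy : (q ^ 2) ^ m = y at *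
    generalize poch (t * q ^ 2) (q ^ 2) m = P at *
    generalize hf : 1 - t * q ^ 2 * y = f at *
    field_simp
    rw [← hf]
    ring
  | succ L ih =>
    rw [Finset.sum_range_succ, ih (by omega)]
    have h1 := recipPoch_succ_left hp (L + 1)
    have h2 := recipPoch_succ_succ (q ^ 2) m L
    have e1 : 1 - t * q ^ 2 * (q ^ 2) ^ (m + L + 1) ≠ 0 :=
      poch_ne_zero_iff.1 hb (m + L + 1) (by omega)
    have e2 := poch_ne_zero_of_le hb (show m + L + 1 ≤ 2 * (m + 1) by omega)
    have e3 : 1 - q * q ^ (2 * L) ≠ 0 := poch_ne_zero_iff.1 hq _ (by omega)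
    have e4 : 1 - q * q ^ (2 * L + 1) ≠ 0 := poch_ne_zero_iff.1 hq _ (by omega)
    have e5 := poch_ne_zero_of_le hq (show 2 * L ≤ 2 * (m + 1) by omega)
    have hx : q ^ L ≠ 0 := pow_ne_zero _ hq0
    rw [h2] at h1
    simp only [evenCoeff, evenKernel, h2, choose_two_two_mul_succ]
    rw [show 2 * (L + 1) = 2 * L + 1 + 1 by ring, show m + 1 + (L + 1) = m + L + 1 + 1 by ring,
      show m + (L + 1) = m + L + 1 by ring]
    rw [poch_succ _ _ (m + L + 1), poch_succ _ _ (2 * L + 1), poch_succ _ _ (2 * L),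
      poch_succ _ _ (2 * L + 1), poch_succ _ _ (2 * L)]
    have h3 : recipPoch (q ^ 2) m (L + 1) = (1 - (q ^ m / q ^ L) ^ 2) * recipPoch (q ^ 2) m L := by
      apply mul_left_cancel₀ (pow_ne_zero (L + 1) (pow_ne_zero 2 hq0))
      rw [← h1]
      field_simp
      ring
    rw [h3]
    rw [show q ^ (2 * L + 1) = (q ^ L) ^ 2 * q by ring] at *
    rw [show q ^ (2 * L + 1 + 1) = (q ^ L) ^ 2 * q ^ 2 by ring] at *
    rw [show q ^ (2 * L + 1 + 1 + 1) = (q ^ L) ^ 2 * q ^ 3 by ring] at *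
    rw [show q ^ (2 * L) = (q ^ L) ^ 2 by ring] at *
    rw [show q ^ (4 * (L + 1)) = (q ^ L) ^ 4 * q ^ 4 by ring] at *
    rw [show (q ^ 2) ^ (m + L + 1) = (q ^ m) ^ 2 * (q ^ L) ^ 2 * q ^ 2 by ring] at *
    rw [show q ^ (2 * m + 1) = (q ^ m) ^ 2 * q by ring] at *
    rw [show q ^ (2 * m + 2) = (q ^ m) ^ 2 * q ^ 2 by ring] at *
    rw [show q ^ (2 * m + 1 + 2 * L) = (q ^ m) ^ 2 * q * (q ^ L) ^ 2 by ring] at *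
    rw [show q ^ (2 * m + 1 + (2 * L + 1 + 1)) = (q ^ m) ^ 2 * q ^ 3 * (q ^ L) ^ 2 by ring] at *
    rw [pow_add q _ (4 * L + 1)]
    rw [show q ^ (4 * L + 1) = (q ^ L) ^ 4 * q by ring]
    generalize recipPoch (q ^ 2) m L = J at *
    generalize q ^ (2 * L).choose 2 = c at *
    generalize poch t q (2 * L) = T at *
    generalize poch q q (2 * L) = Q at *
    generalize poch (t * q ^ 2) (q ^ 2) (m + L + 1) = B at *
    generalize q ^ L = x at *
    generalize q ^ m = y at *
    generalize hf : 1 - t * q ^ 2 * (y ^ 2 * x ^ 2 * q ^ 2) = f at *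
    generalize hg : 1 - q * x ^ 2 = g at *
    generalize hh : 1 - q * (x ^ 2 * q) = h at *
    generalize 1 - t = s at *
    field_simp
    rw [← hf, ← hg, ← hh]
    ring

theorem sum_evenCoeff {t q : K} (hq0 : q ≠ 0) (ht : 1 - t ≠ 0) (m : ℕ)
    (hq : poch q q (2 * m) ≠ 0) (hp : poch (q ^ 2) (q ^ 2) m ≠ 0)
    (hb : poch (t * q ^ 2) (q ^ 2) (2 * m) ≠ 0) :
    ∑ r ∈ Finset.range (m + 1), evenCoeff t q r * evenKernel t q m r = (poch q q (2 * m))⁻¹ := by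
  induction m with
  | zero => simp [evenCoeff, evenKernel, recipPoch, ht]
  | succ m ih =>
    have h := evenCoeff_partial hq0 ht hq hp hb (m + 1) le_rfl
    have h0 : recipPoch (q ^ 2) m (m + 1) = 0 := recipPoch_of_lt _ (Nat.lt_succ_self m)
    have ih' := ih (poch_ne_zero_of_le hq (by omega)) (poch_ne_zero_of_le hp (by omega))
      (poch_ne_zero_of_le hb (by omega))
    have h1 : evenKernel t q m (m + 1) = 0 := by simp [evenKernel, h0]
    rw [h0, zero_div, mul_zero, Finset.sum_sub_distrib, ← Finset.mul_sum,
      Finset.sum_range_succ (fun r => evenCoeff t q r * evenKernel t q m r), h1, mul_zero,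
      add_zero, ih', sub_eq_zero] at h
    have e1 : 1 - q * q ^ (2 * m) ≠ 0 := poch_ne_zero_iff.1 hq _ (by omega)
    have e2 : 1 - q * q ^ (2 * m + 1) ≠ 0 := poch_ne_zero_iff.1 hq _ (by omega)
    rw [show 2 * (m + 1) = 2 * m + 1 + 1 by ring, poch_succ, poch_succ]
    rw [← pow_succ'] at e1 e2 ⊢
    apply mul_left_cancel₀ (mul_ne_zero e1 e2)
    rw [← pow_succ', h, mul_inv, mul_inv]
    field_simp

/-! ### Expansion of 1/(q)_m in the parity-dependent kernel -/

/-- The coefficient of the expansion of `1 / (q)_m` in the kernel `parityKernel`. -/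
def parityCoeff (t q : K) (r : ℕ) : K :=
  poch (t ^ 2 * q ^ 2) (q ^ 2) r * q ^ (r + 1).choose 2 * (1 - t) * poch (t ^ 2 * q) q r /
    (poch q q r * (1 - t * q ^ r) * (1 - t * q ^ (r + 1)) * poch (t ^ 2 * q) q (2 * r))

/-- The eigenvectors of the kernel `1 / (q²; q²)_{⌊m / 2⌋}`, with `w = z q ^ r` and `N = m - r`. -/
def parityKernel (w q : K) (N : ℕ) : K :=
  (if Even N then 1 - w * q ^ N else 1) /
    (poch (q ^ 2) (q ^ 2) (N / 2) * poch (w ^ 2 * q) (q ^ 2) (N / 2))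

theorem parityKernel_even (w q : K) (i : ℕ) : parityKernel w q (2 * i) =
    (1 - w * q ^ (2 * i)) / (poch (q ^ 2) (q ^ 2) i * poch (w ^ 2 * q) (q ^ 2) i) := by
  simp [parityKernel]

theorem parityKernel_odd (w q : K) (i : ℕ) : parityKernel w q (2 * i + 1) =
    1 / (poch (q ^ 2) (q ^ 2) i * poch (w ^ 2 * q) (q ^ 2) i) := by
  have : ¬ Even (2 * i + 1) := by simp
  rw [parityKernel, if_neg this, show (2 * i + 1) / 2 = i by omega]

/-- The left side is the block that appears in the closed partial sums of `parityDiff`. -/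
theorem parityCoeff_succ {t q : K} {r : ℕ} (hq : poch q q (r + 1) ≠ 0)
    (ht : ∀ i ≤ r + 2, 1 - t * q ^ i ≠ 0) (ht2 : poch (t ^ 2 * q) q (2 * (r + 1)) ≠ 0) :
    (1 - q ^ (r + 1)) * (1 - t * q ^ (r + 2)) * parityCoeff t q (r + 1) =
      q ^ (r + 1) * (1 - t * q ^ r) * (1 - t ^ 2 * q ^ (r + 1)) / (1 - t ^ 2 * q ^ (2 * r + 1)) *
        parityCoeff t q r := by
  have e1 : 1 - q * q ^ r ≠ 0 := poch_ne_zero_iff.1 hq _ (by omega)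
  have e2 : 1 - t ^ 2 * q * q ^ (2 * r) ≠ 0 := poch_ne_zero_iff.1 ht2 _ (by omega)
  have e3 : 1 - t ^ 2 * q * q ^ (2 * r + 1) ≠ 0 := poch_ne_zero_iff.1 ht2 _ (by omega)
  have e4 := poch_ne_zero_of_le ht2 (show 2 * r ≤ 2 * (r + 1) by omega)
  have e5 := poch_ne_zero_of_le hq (show r ≤ r + 1 by omega)
  have e6 := ht r (by omega)
  have e7 := ht (r + 1) (by omega)
  have e8 := ht (r + 2) (by omega)
  rw [show 1 - t ^ 2 * q ^ (2 * r + 1) = 1 - t ^ 2 * q * q ^ (2 * r) by ring,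
    show 1 - q ^ (r + 1) = 1 - q * q ^ r by ring]
  simp only [parityCoeff]
  rw [show 2 * (r + 1) = 2 * r + 1 + 1 by ring, poch_succ _ _ (2 * r + 1), poch_succ _ _ (2 * r),
    poch_succ _ _ r, poch_succ _ _ r, poch_succ _ _ r, show r + 1 + 1 = r + 2 by ring]
  rw [show t ^ 2 * q ^ 2 * (q ^ 2) ^ r = t ^ 2 * q * q ^ (2 * r + 1) by ring]
  rw [show (r + 2).choose 2 = (r + 1).choose 2 + (r + 1) by
    rw [Nat.choose_succ_succ' (r + 1) 1]; simp; ring]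
  rw [show t ^ 2 * q ^ (r + 1) = t ^ 2 * q * q ^ r by ring]
  generalize 1 - q * q ^ r = a1 at *
  generalize 1 - t ^ 2 * q * q ^ (2 * r) = a2 at *
  generalize 1 - t ^ 2 * q * q ^ (2 * r + 1) = a3 at *
  generalize 1 - t * q ^ r = a4 at *
  generalize 1 - t * q ^ (r + 1) = a5 at *
  generalize 1 - t * q ^ (r + 2) = a6 at *
  generalize poch q q r = a7 at *
  generalize poch (t ^ 2 * q) q (2 * r) = a8 at *
  field_simp
  ring

theorem poch_succ' (a q : K) (n : ℕ) : poch a q (n + 1) = (1 - a) * poch (a * q) q n := by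
  rw [add_comm, poch_add]
  simp [poch]

/-- The difference whose partial sums telescope in the expansion of `1 / (q)_m`. -/
def parityDiff (t q : K) (m r : ℕ) : K :=
  (1 - q ^ (m + 1)) * (parityCoeff t q r * parityKernel (t * q ^ (r + 1)) q (m + 1 - r)) -
    parityCoeff t q r * parityKernel (t * q ^ (r + 1)) q (m - r)

/-- One telescoping step with m - r = 2i: the first term is the partial sum up to r, the right side
the partial sum up to r + 1, where the distance to m has become odd. -/
theorem parityDiff_even {t q : K} {i r : ℕ} (hq : poch q q (r + 1) ≠ 0)
    (ht : ∀ i ≤ r + 2, 1 - t * q ^ i ≠ 0) (ht2 : poch (t ^ 2 * q) q (2 * (r + 1)) ≠ 0)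
    (hp : poch (q ^ 2) (q ^ 2) i ≠ 0)
    (hb : poch (t ^ 2 * q ^ (2 * r + 3)) (q ^ 2) i ≠ 0) :
    -t * q ^ (r + 2 * i + 1) * (1 - q ^ r) * (1 - t * q ^ (r + 1)) * parityCoeff t q r /
        (poch (q ^ 2) (q ^ 2) i * poch (t ^ 2 * q ^ (2 * r + 1)) (q ^ 2) (i + 1)) +
      parityDiff t q (r + 2 * i) r =
    -q ^ (2 * i) * ((1 - q ^ (r + 1)) * (1 - t * q ^ (r + 2)) * parityCoeff t q (r + 1)) /
        (poch (q ^ 2) (q ^ 2) i * poch (t ^ 2 * q ^ (2 * r + 3)) (q ^ 2) i) := by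
  have e2 : 1 - t ^ 2 * q * q ^ (2 * r) ≠ 0 := poch_ne_zero_iff.1 ht2 _ (by omega)
  rw [parityDiff, parityCoeff_succ hq ht ht2, poch_succ']
  rw [show r + 2 * i + 1 - r = 2 * i + 1 by omega, show r + 2 * i - r = 2 * i by omega,
    parityKernel_odd, parityKernel_even]
  rw [show t ^ 2 * q ^ (2 * r + 1) * q ^ 2 = t ^ 2 * q ^ (2 * r + 3) by ring,
    show (t * q ^ (r + 1)) ^ 2 * q = t ^ 2 * q ^ (2 * r + 3) by ring]
  rw [show t ^ 2 * q ^ (2 * r + 1) = t ^ 2 * q * q ^ (2 * r) by ring]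
  generalize poch (q ^ 2) (q ^ 2) i = a1 at *
  generalize poch (t ^ 2 * q ^ (2 * r + 3)) (q ^ 2) i = a2 at *
  generalize hf : 1 - t ^ 2 * q * q ^ (2 * r) = f at *
  field_simp
  rw [← hf]
  ring

theorem parityDiff_odd {t q : K} {i r : ℕ} (hq : poch q q (r + 1) ≠ 0)
    (ht : ∀ i ≤ r + 2, 1 - t * q ^ i ≠ 0) (ht2 : poch (t ^ 2 * q) q (2 * (r + 1)) ≠ 0)
    (hp : poch (q ^ 2) (q ^ 2) (i + 1) ≠ 0)
    (hb : poch (t ^ 2 * q ^ (2 * r + 3)) (q ^ 2) (i + 1) ≠ 0) :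
    - q ^ (2 * i + 2) * ((1 - q ^ r) * (1 - t * q ^ (r + 1)) * parityCoeff t q r) /
        (poch (q ^ 2) (q ^ 2) (i + 1) * poch (t ^ 2 * q ^ (2 * r + 1)) (q ^ 2) (i + 1)) +
      parityDiff t q (r + 2 * i + 1) r =
    -t * q ^ (r + 2 * i + 2) *
        ((1 - q ^ (r + 1)) * (1 - t * q ^ (r + 2)) * parityCoeff t q (r + 1)) /
        (poch (q ^ 2) (q ^ 2) i * poch (t ^ 2 * q ^ (2 * r + 3)) (q ^ 2) (i + 1)) := by
  have e2 : 1 - t ^ 2 * q * q ^ (2 * r) ≠ 0 := poch_ne_zero_iff.1 ht2 _ (by omega)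
  have e3 : 1 - q ^ 2 * (q ^ 2) ^ i ≠ 0 := poch_ne_zero_iff.1 hp _ (by omega)
  have e4 : 1 - t ^ 2 * q ^ (2 * r + 3) * (q ^ 2) ^ i ≠ 0 := poch_ne_zero_iff.1 hb _ (by omega)
  have e5 := poch_ne_zero_of_le hp (show i ≤ i + 1 by omega)
  have e6 := poch_ne_zero_of_le hb (show i ≤ i + 1 by omega)
  rw [parityDiff, parityCoeff_succ hq ht ht2, poch_succ' (t ^ 2 * q ^ (2 * r + 1)), poch_succ,
    show r + 2 * i + 1 + 1 - r = 2 * (i + 1) by omega,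
    show r + 2 * i + 1 - r = 2 * i + 1 by omega, parityKernel_odd, parityKernel_even, poch_succ]
  rw [show t ^ 2 * q ^ (2 * r + 1) * q ^ 2 = t ^ 2 * q ^ (2 * r + 3) by ring,
    show (t * q ^ (r + 1)) ^ 2 * q = t ^ 2 * q ^ (2 * r + 3) by ring, poch_succ]
  rw [show t ^ 2 * q ^ (2 * r + 1) = t ^ 2 * q * q ^ (2 * r) by ring]
  generalize poch (q ^ 2) (q ^ 2) i = a1 at *
  generalize poch (t ^ 2 * q ^ (2 * r + 3)) (q ^ 2) i = a2 at *
  generalize parityCoeff t q r = c at *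
  rw [show (q ^ 2) ^ i = (q ^ i) ^ 2 by ring] at *
  simp only [pow_add, pow_mul', mul_add] at *
  generalize q ^ r = x at *
  generalize q ^ i = y at *
  generalize hf : 1 - t ^ 2 * q * x ^ 2 = f at *
  generalize hg : 1 - q ^ 2 * y ^ 2 = g at *
  generalize hh : 1 - t ^ 2 * (x ^ 2 * q ^ 3) * y ^ 2 = h at *
  field_simp
  rw [← hf, ← hg, ← hh]
  ring

/-- The antidifference has two shapes according to the parity of m - L, and each step swaps them:
`parityDiff_even` leads from the second to the first, `parityDiff_odd` from the first to the second.
Hence both are carried through one induction. -/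
theorem parityDiff_partial {t q : K} {m : ℕ} (hq : poch q q (m + 1) ≠ 0)
    (ht : ∀ i ≤ m + 2, 1 - t * q ^ i ≠ 0) (ht2 : poch (t ^ 2 * q) q (2 * m + 2) ≠ 0)
    (hp : ∀ i, 2 * i ≤ m + 1 → poch (q ^ 2) (q ^ 2) i ≠ 0) (L : ℕ) (hL : L ≤ m + 1) :
    (∀ i, m + 1 = L + 2 * i → ∑ r ∈ Finset.range L, parityDiff t q m r =
      - q ^ (2 * i) * ((1 - q ^ L) * (1 - t * q ^ (L + 1)) * parityCoeff t q L) /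
        (poch (q ^ 2) (q ^ 2) i * poch (t ^ 2 * q ^ (2 * L + 1)) (q ^ 2) i)) ∧
    (∀ i, m = L + 2 * i → ∑ r ∈ Finset.range L, parityDiff t q m r =
      -t * q ^ (L + 2 * i + 1) * (1 - q ^ L) * (1 - t * q ^ (L + 1)) * parityCoeff t q L /
        (poch (q ^ 2) (q ^ 2) i * poch (t ^ 2 * q ^ (2 * L + 1)) (q ^ 2) (i + 1))) := by
  induction L with
  | zero => simp
  | succ L ih =>
    obtain ⟨ih1, ih2⟩ := ih (by omega)
    have hb : ∀ i, L + 2 * i ≤ m + 1 → poch (t ^ 2 * q ^ (2 * L + 3)) (q ^ 2) i ≠ 0 := by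
      intro i hi
      rw [poch_ne_zero_iff]
      intro j hj
      have := poch_ne_zero_iff.1 ht2 (2 * L + 2 + 2 * j) (by omega)
      convert this using 2
      ring
    have hq' := poch_ne_zero_of_le hq (show L + 1 ≤ m + 1 by omega)
    have ht' : ∀ i ≤ L + 2, 1 - t * q ^ i ≠ 0 := fun i hi => ht i (by omega)
    have ht2' := poch_ne_zero_of_le ht2 (show 2 * (L + 1) ≤ 2 * m + 2 by omega)
    constructor
    · intro i hi
      rw [Finset.sum_range_succ, ih2 i (by omega)]
      obtain rfl : m = L + 2 * i := by omega
      exact parityDiff_even hq' ht' ht2' (hp i (by omega)) (hb i (by omega))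
    · intro i hi
      rw [Finset.sum_range_succ, ih1 (i + 1) (by omega)]
      obtain rfl : m = L + 2 * i + 1 := by omega
      have := parityDiff_odd (i := i) hq' ht' ht2' (hp (i + 1) (by omega)) (hb (i + 1) (by omega))
      rw [show 2 * (i + 1) = 2 * i + 2 by ring, this]
      rw [show L + 1 + 2 * i + 1 = L + 2 * i + 2 by ring,
        show 2 * (L + 1) + 1 = 2 * L + 3 by ring]
      ring

theorem sum_parityCoeff {t q : K} (m : ℕ) (hq : poch q q m ≠ 0)
    (ht : ∀ i ≤ m + 1, 1 - t * q ^ i ≠ 0) (ht2 : poch (t ^ 2 * q) q (2 * m) ≠ 0)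
    (hp : ∀ i, 2 * i ≤ m → poch (q ^ 2) (q ^ 2) i ≠ 0) :
    ∑ r ∈ Finset.range (m + 1),
      parityCoeff t q r * parityKernel (t * q ^ (r + 1)) q (m - r) = (poch q q m)⁻¹ := by
  induction m with
  | zero =>
    have h0 := ht 0 (by omega)
    have h1 := ht 1 (by omega)
    simp only [pow_zero, pow_one, mul_one] at h0 h1
    simp [parityCoeff, parityKernel]
    field_simp
  | succ m ih =>
    have ih' := ih (poch_ne_zero_of_le hq (by omega)) (fun i hi => ht i (by omega))
      (poch_ne_zero_of_le ht2 (by omega)) (fun i hi => hp i (by omega))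
    have h := (parityDiff_partial hq ht ht2 hp (m + 1) le_rfl).1 0 rfl
    simp only [parityDiff, Finset.sum_sub_distrib, ← Finset.mul_sum] at h
    rw [ih'] at h
    have e1 : 1 - q * q ^ m ≠ 0 := poch_ne_zero_iff.1 hq _ (by omega)
    -- The term r = m + 1 is kept out of the telescoping: there m - r truncates to 0, so
    -- `parityDiff` would subtract a spurious nonzero kernel value. It is exactly what the partial
    -- sum up to m leaves over.
    rw [poch_succ, Finset.sum_range_succ]
    have h2 : parityKernel (t * q ^ (m + 1 + 1)) q (m + 1 - (m + 1)) = 1 - t * q ^ (m + 2) := by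
      simp [parityKernel]
    rw [h2]
    rw [← pow_succ'] at e1 ⊢
    simp only [mul_zero, pow_zero, poch_zero, mul_one, div_one] at h
    apply mul_left_cancel₀ e1
    rw [mul_inv, mul_comm (poch q q m)⁻¹, mul_inv_cancel_left₀ e1]
    linear_combination h

/-! ### Eigenvector and q-Gauss relations for the parity kernel -/

theorem recipPoch_succ_right {q : K} {n : ℕ} (hq : poch q q n ≠ 0) (l : ℕ) :
    (q ^ l - q ^ n) * recipPoch q n l = q ^ l * recipPoch q n (l + 1) := by
  rcases lt_trichotomy l n with h | h | h
  · obtain ⟨m, rfl⟩ : ∃ m, n = m + 1 + l := ⟨n - l - 1, by omega⟩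
    have h1 : 1 - q * q ^ m ≠ 0 := poch_ne_zero_iff.1 hq m (by omega)
    have h2 : poch q q m ≠ 0 := poch_ne_zero_of_le hq (by omega)
    rw [recipPoch_add, show m + 1 + l = m + (l + 1) by ring, recipPoch_add, poch_succ]
    field_simp
    ring
  · subst h
    rw [recipPoch_of_lt q (Nat.lt_succ_self l)]
    ring
  · rw [recipPoch_of_lt q h, recipPoch_of_lt q (by omega)]
    ring

theorem sum_range_two_mul (f : ℕ → K) (n : ℕ) :
    ∑ l ∈ Finset.range (2 * n), f l =
      ∑ l ∈ Finset.range n, (f (2 * l) + f (2 * l + 1)) := by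
  induction n with
  | zero => simp
  | succ n ih =>
    rw [show 2 * (n + 1) = 2 * n + 1 + 1 by ring, Finset.sum_range_succ, Finset.sum_range_succ, ih,
      Finset.sum_range_succ, add_assoc]

theorem choose_two_succ (l : ℕ) : (l + 1).choose 2 = l.choose 2 + l := by
  rw [Nat.choose_succ_succ' l 1, Nat.choose_one_right, add_comm]

theorem vandermondeTerm_sq (w q : K) (i l : ℕ) :
    vandermondeTerm (w * q) (q ^ 2) i l = w ^ l * q ^ (2 * l).choose 2 *
      recipPoch (q ^ 2) i l / (poch (q ^ 2) (q ^ 2) l * poch (w * q) (q ^ 2) l) := by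
  rw [vandermondeTerm, choose_two_two_mul]
  congr 2
  rw [← pow_mul, mul_pow]
  ring

/-- Pair the indices 2l and 2l + 1. For N = 2i a pair sums to (1 - w q^{2i}) times a q-Vandermonde
summand with base q² and b = w² q; for N = 2i + 1 the two terms in w q^{2l} cancel and the bare
summand remains. -/
theorem sum_parityKernel_eigen {w q : K} (hq0 : q ≠ 0) (N : ℕ)
    (hp : poch (q ^ 2) (q ^ 2) (N / 2) ≠ 0) (hb : poch (w ^ 2 * q) (q ^ 2) (N / 2) ≠ 0) :
    ∑ l ∈ Finset.range (N + 1), (poch (q ^ 2) (q ^ 2) ((N - l) / 2))⁻¹ *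
      (w ^ l * q ^ l.choose 2) * parityKernel w q l = parityKernel w q N := by
  have hv := sum_vandermonde (pow_ne_zero 2 hq0) (N / 2) hp hb
  simp only [vandermondeTerm_sq] at hv
  rcases Nat.even_or_odd' N with ⟨i, rfl | rfl⟩
  · rw [show 2 * i / 2 = i by omega] at *
    rw [parityKernel_even, div_eq_mul_inv, ← hv, Finset.sum_range_succ, sum_range_two_mul,
      Finset.sum_range_succ, mul_add, Finset.mul_sum]
    congr 1
    · refine Finset.sum_congr rfl fun l hl => ?_
      rw [Finset.mem_range] at hl
      rw [show (2 * i - 2 * l) / 2 = i - l by omega,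
        show (2 * i - (2 * l + 1)) / 2 = i - (l + 1) by omega, choose_two_succ,
        parityKernel_even, parityKernel_odd, ← recipPoch_of_le _ hl.le,
        ← recipPoch_of_le _ (Nat.succ_le_iff.2 hl)]
      have h := recipPoch_succ_right hp l
      simp only [← pow_mul] at h
      linear_combination (-(w ^ (2 * l) * q ^ (2 * l).choose 2 * w /
        (poch (q ^ 2) (q ^ 2) l * poch (w ^ 2 * q) (q ^ 2) l))) * h
    -- The index 2i has no partner, but its factor already is 1 - w q^{2i}.
    · rw [parityKernel_even, recipPoch_self]
      simp
      ring
  · rw [show (2 * i + 1) / 2 = i by omega] at *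
    rw [parityKernel_odd, one_div, ← hv, show 2 * i + 1 + 1 = 2 * (i + 1) by ring,
      sum_range_two_mul]
    refine Finset.sum_congr rfl fun l hl => ?_
    have hl' : l ≤ i := by rw [Finset.mem_range] at hl; omega
    rw [show (2 * i + 1 - 2 * l) / 2 = i - l by omega,
        show (2 * i + 1 - (2 * l + 1)) / 2 = i - l by omega, choose_two_succ,
        parityKernel_even, parityKernel_odd, ← recipPoch_of_le _ hl']
    ring

/-- The same pairing of 2l with 2l + 1 gives 1 - w q^N times the q-Gauss summand with u = w². -/
theorem sum_parityKernel_gauss {w q : K} (hq0 : q ≠ 0) (N : ℕ) (hq : poch q q N ≠ 0)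
    (hp : poch (q ^ 2) (q ^ 2) (N / 2) ≠ 0) (hb : poch (w ^ 2 * q) (q ^ 2) (N / 2) ≠ 0)
    (hw : poch (w ^ 2) q N ≠ 0) :
    ∑ l ∈ Finset.range (N + 1), recipPoch q N l * (w ^ l * q ^ l.choose 2) * parityKernel w q l =
      (1 - w * q ^ N) * (poch (w ^ 2) (q ^ 2) N / (poch q q N * poch (w ^ 2) q N)) := by
  rw [← sum_gauss hq0 (N / 2) hp hb N (by omega) hq hw]
  -- The range is rounded up to even length so that all indices pair; any added term is zero.
  have h1 : ∑ l ∈ Finset.range (N + 1),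
        recipPoch q N l * (w ^ l * q ^ l.choose 2) * parityKernel w q l =
      ∑ l ∈ Finset.range (2 * (N / 2 + 1)),
        recipPoch q N l * (w ^ l * q ^ l.choose 2) * parityKernel w q l := by
    apply Finset.sum_subset
    · intro l; simp only [Finset.mem_range]; omega
    · intro l _ h
      rw [recipPoch_of_lt q (by simpa using h)]
      ring
  rw [h1, sum_range_two_mul, Finset.mul_sum]
  refine Finset.sum_congr rfl fun l _ => ?_
  rw [choose_two_succ, parityKernel_even, parityKernel_odd, gaussTerm]
  have h := recipPoch_succ_right hq (2 * l)
  linear_combination (-(w ^ (2 * l) * q ^ (2 * l).choose 2 * w /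
        (poch (q ^ 2) (q ^ 2) l * poch (w ^ 2 * q) (q ^ 2) l))) * h

end FiniteIdentities

/-! ### Iterated sums and their diagonalization -/

section Chains

variable {K : Type*} [Field K]

/-- The iterated sums `v_{s+1}(m) = ∑_{j ≤ m} κ(m - j) D(j) v_s(j)`. -/
def chain (κ D v : ℕ → K) : ℕ → ℕ → K
  | 0, m => v m
  | s + 1, m => ∑ j ∈ Finset.range (m + 1), κ (m - j) * D j * chain κ D v s j

theorem sum_range_triangle (m : ℕ) (F : ℕ → ℕ → K) :
    ∑ j ∈ Finset.range (m + 1), ∑ r ∈ Finset.range (j + 1), F j r =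
      ∑ r ∈ Finset.range (m + 1), ∑ j ∈ Finset.Icc r m, F j r := by
  apply Finset.sum_comm'
  intro x y
  simp only [Finset.mem_range, Finset.mem_Icc]
  omega

/-- In an eigenbasis the s-th power of a matrix acts by s-th powers of eigenvalues. All is truncated
at B because in the applications the denominators are known to be nonzero only in that range. -/
theorem chain_eigen {κ D v α : ℕ → K} {M : ℕ → ℕ → K} {B : ℕ}
    (hT : ∀ r m, r ≤ m → m ≤ B →
      ∑ j ∈ Finset.Icc r m, κ (m - j) * D j * M j r = D r * M m r)
    (h0 : ∀ m ≤ B, ∑ r ∈ Finset.range (m + 1), α r * M m r = v m) (s m : ℕ) (hm : m ≤ B) :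
    chain κ D v s m = ∑ r ∈ Finset.range (m + 1), α r * D r ^ s * M m r := by
  induction s generalizing m with
  | zero => simp [chain, h0 m hm]
  | succ s ih =>
    rw [chain]
    have : ∀ j ∈ Finset.range (m + 1), κ (m - j) * D j * chain κ D v s j =
        ∑ r ∈ Finset.range (j + 1), α r * D r ^ s * (κ (m - j) * D j * M j r) := by
      intro j hj
      rw [Finset.mem_range] at hj
      rw [ih j (by omega), Finset.mul_sum]
      exact Finset.sum_congr rfl fun r _ => by ring
    rw [Finset.sum_congr rfl this, sum_range_triangle]
    refine Finset.sum_congr rfl fun r hr => ?_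
    rw [Finset.mem_range] at hr
    rw [← Finset.mul_sum, hT r m (by omega) hm]
    ring

theorem sum_chain_eigen {κ D v α A N : ℕ → K} {M : ℕ → ℕ → K} {B : ℕ}
    (hT : ∀ r m, r ≤ m → m ≤ B →
      ∑ j ∈ Finset.Icc r m, κ (m - j) * D j * M j r = D r * M m r)
    (h0 : ∀ m ≤ B, ∑ r ∈ Finset.range (m + 1), α r * M m r = v m)
    (hA : ∀ r ≤ B, ∑ j ∈ Finset.Icc r B, A j * D j * M j r = D r * N r) (s : ℕ) :
    ∑ j ∈ Finset.range (B + 1), A j * D j * chain κ D v s j =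
      ∑ r ∈ Finset.range (B + 1), α r * D r ^ (s + 1) * N r := by
  have : ∀ j ∈ Finset.range (B + 1), A j * D j * chain κ D v s j =
      ∑ r ∈ Finset.range (j + 1), α r * D r ^ s * (A j * D j * M j r) := by
    intro j hj
    rw [Finset.mem_range] at hj
    rw [chain_eigen hT h0 s j (by omega), Finset.mul_sum]
    exact Finset.sum_congr rfl fun r _ => by ring
  rw [Finset.sum_congr rfl this, sum_range_triangle]
  refine Finset.sum_congr rfl fun r hr => ?_
  rw [Finset.mem_range] at hr
  rw [← Finset.mul_sum, hA r (by omega)]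
  ring

/-- The sequence `m, f 0, f 1, …`. -/
def seqCons (m : ℕ) (f : ℕ → ℕ) : ℕ → ℕ
  | 0 => m
  | i + 1 => f i

open Classical in
/-- The antitone sequences `f` with `f 0 ≤ n` and `f k = 0`. -/
noncomputable def boxed : ℕ → ℕ → Finset (ℕ → ℕ)
  | 0, _ => {0}
  | k + 1, n => (Finset.range (n + 1)).biUnion fun m => (boxed k m).image (seqCons m)

theorem seqCons_injective (m : ℕ) : Function.Injective (seqCons m) := fun _ _ h =>
  funext fun i => congrFun h (i + 1)

theorem mem_boxed {k n : ℕ} {f : ℕ → ℕ} :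
    f ∈ boxed k n ↔ Antitone f ∧ f k = 0 ∧ f 0 ≤ n := by
  induction k generalizing n f with
  | zero =>
    simp only [boxed, Finset.mem_singleton]
    constructor
    · rintro rfl
      exact ⟨fun _ _ _ => le_rfl, rfl, Nat.zero_le _⟩
    · rintro ⟨h1, h2, -⟩
      funext i
      have := h1 (Nat.zero_le i)
      simp only [Pi.zero_apply]
      omega
  | succ k ih =>
    simp only [boxed, Finset.mem_biUnion, Finset.mem_range, Finset.mem_image]
    constructor
    · rintro ⟨m, hm, g, hg, rfl⟩
      obtain ⟨h1, h2, h3⟩ := ih.1 hg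
      refine ⟨antitone_nat_of_succ_le fun i => ?_, h2, by simp only [seqCons]; omega⟩
      cases i with
      | zero => exact h3
      | succ i => exact h1 (Nat.le_succ i)
    · rintro ⟨h1, h2, h3⟩
      refine ⟨f 0, by omega, fun i => f (i + 1), ih.2 ⟨fun i j h => h1 (by omega), h2,
        h1 (by omega)⟩, ?_⟩
      funext i
      cases i <;> rfl

theorem sum_boxed_succ (k n : ℕ) (F : (ℕ → ℕ) → K) :
    ∑ f ∈ boxed (k + 1) n, F f =
      ∑ m ∈ Finset.range (n + 1), ∑ f ∈ boxed k m, F (seqCons m f) := by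
  classical
  rw [boxed, Finset.sum_biUnion]
  · refine Finset.sum_congr rfl fun m _ => ?_
    rw [Finset.sum_image (seqCons_injective m).injOn]
  · intro a _ b _ hab
    rw [Function.onFun, Finset.disjoint_left]
    intro f hf hf'
    simp only [Finset.mem_image] at hf hf'
    obtain ⟨g, -, rfl⟩ := hf
    obtain ⟨g', -, h⟩ := hf'
    exact hab (congrFun h 0).symm

/-- The product `D(f 0) ∏_{i < s} κ(f i - f (i + 1)) D(f (i + 1)) ⋅ v(f s)`. -/
def weight (κ D v : ℕ → K) (s : ℕ) (f : ℕ → ℕ) : K :=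
  D (f 0) * (∏ i ∈ Finset.range s, κ (f i - f (i + 1)) * D (f (i + 1))) * v (f s)

/-- Fixing the largest entry of a sequence leaves a sum of the same kind below it, one step of the
iterated sum. -/
theorem sum_boxed_weight (κ D v A : ℕ → K) (s n : ℕ) :
    ∑ f ∈ boxed (s + 1) n, A (f 0) * weight κ D v s f =
      ∑ m ∈ Finset.range (n + 1), A m * D m * chain κ D v s m := by
  induction s generalizing n A with
  | zero =>
    rw [sum_boxed_succ]
    simp [boxed, weight, chain, seqCons, mul_assoc]
  | succ s ih =>
    rw [sum_boxed_succ]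
    refine Finset.sum_congr rfl fun m _ => ?_
    -- The induction hypothesis is used with A replaced by κ(m - ·), hence the generalization over
    -- A.
    rw [chain, ← ih, Finset.mul_sum]
    refine Finset.sum_congr rfl fun f _ => ?_
    simp only [weight, seqCons]
    rw [Finset.prod_range_succ']
    ring

end Chains

/-! ### Partitions as antitone sequences -/

section Diagrams

theorem rowLen_injective : Function.Injective YoungDiagram.rowLen := by
  intro μ ν h
  ext ⟨i, j⟩
  rw [YoungDiagram.mem_cells, YoungDiagram.mem_cells, YoungDiagram.mem_iff_lt_rowLen,
    YoungDiagram.mem_iff_lt_rowLen, h]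

theorem rowLen_eq_of_forall {μ : YoungDiagram} {i a : ℕ} (h : ∀ j, (i, j) ∈ μ ↔ j < a) :
    μ.rowLen i = a :=
  eq_of_forall_lt_iff fun j => by rw [← YoungDiagram.mem_iff_lt_rowLen, h]

theorem mem_lengthLE_iff {k : ℕ} {μ : YoungDiagram} : μ ∈ lengthLE k ↔ μ.rowLen k = 0 := by
  rw [lengthLE, Set.mem_ofPred_eq, ← not_lt, ← YoungDiagram.mem_iff_lt_colLen,
    YoungDiagram.mem_iff_lt_rowLen]
  omega

theorem exists_rowLen_eq {k : ℕ} {f : ℕ → ℕ} (hf : Antitone f) (hk : f k = 0) :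
    ∃ μ : YoungDiagram, μ.rowLen = f := by
  refine ⟨⟨(Finset.range k ×ˢ Finset.range (f 0)).filter fun c => c.2 < f c.1, ?_⟩, ?_⟩
  · rintro ⟨i, j⟩ ⟨i', j'⟩ h hc
    simp only [Prod.mk_le_mk] at h
    simp only [Finset.coe_filter, Finset.mem_product, Finset.mem_range, Set.mem_ofPred_eq] at hc ⊢
    have := hf h.1
    omega
  · funext i
    apply rowLen_eq_of_forall
    intro j
    rw [← YoungDiagram.mem_cells]
    change (i, j) ∈ Finset.filter _ _ ↔ _
    simp only [Finset.mem_filter, Finset.mem_product, Finset.mem_range]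
    have := hf (Nat.zero_le i)
    refine ⟨fun h => h.2, fun h => ⟨⟨?_, by omega⟩, h⟩⟩
    by_contra! h'
    have := hf h'
    omega

theorem rowLen_image (k n : ℕ) :
    YoungDiagram.rowLen '' {μ ∈ lengthLE k | μ.rowLen 0 ≤ n} = ↑(boxed k n) := by
  ext f
  simp only [Set.mem_image, Set.mem_ofPred_eq, Finset.mem_coe, mem_boxed, mem_lengthLE_iff]
  constructor
  · rintro ⟨μ, ⟨h1, h2⟩, rfl⟩
    exact ⟨fun i j h => μ.rowLen_anti i j h, h1, h2⟩
  · rintro ⟨h1, h2, h3⟩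
    obtain ⟨μ, rfl⟩ := exists_rowLen_eq h1 h2
    exact ⟨μ, ⟨h2, h3⟩, rfl⟩

/-- A partition is determined by its row lengths, and those with at most k parts and largest part at
most n correspond exactly to `boxed k n`. -/
theorem finsum_lengthLE {K : Type*} [Field K] {k n : ℕ} {T : YoungDiagram → K}
    {F : (ℕ → ℕ) → K} (h1 : ∀ μ ∈ lengthLE k, T μ = F μ.rowLen)
    (h2 : ∀ μ ∈ lengthLE k, n < μ.rowLen 0 → T μ = 0) :
    {μ ∈ lengthLE k | T μ ≠ 0}.Finite ∧ ∑ᶠ μ ∈ lengthLE k, T μ = ∑ f ∈ boxed k n, F f := by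
  have hsub : {μ ∈ lengthLE k | T μ ≠ 0} ⊆ {μ ∈ lengthLE k | μ.rowLen 0 ≤ n} := by
    rintro μ ⟨hμ, hT⟩
    exact ⟨hμ, not_lt.1 fun h => hT (h2 μ hμ h)⟩
  have hfin : {μ ∈ lengthLE k | μ.rowLen 0 ≤ n}.Finite := by
    apply Set.Finite.of_finite_image _ rowLen_injective.injOn
    rw [rowLen_image]
    exact Finset.finite_toSet _
  refine ⟨hfin.subset hsub, ?_⟩
  rw [← finsum_mem_coe_finset, ← rowLen_image, finsum_mem_image rowLen_injective.injOn]
  have : ∑ᶠ μ ∈ lengthLE k, T μ = ∑ᶠ μ ∈ {μ ∈ lengthLE k | μ.rowLen 0 ≤ n}, T μ := by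
    apply finsum_mem_inter_support_eq'
    intro μ hμ
    exact ⟨fun h => hsub ⟨h, hμ⟩, fun h => h.1⟩
  rw [this]
  exact finsum_mem_congr rfl fun μ hμ => h1 μ hμ.1

theorem card_eq_sum_rowLen {k : ℕ} {μ : YoungDiagram} (h : μ ∈ lengthLE k) :
    μ.card = ∑ i ∈ Finset.range k, μ.rowLen i := by
  rw [YoungDiagram.card, Finset.card_eq_sum_card_fiberwise (f := Prod.fst) (t := Finset.range k)]
  · refine Finset.sum_congr rfl fun i _ => ?_
    rw [YoungDiagram.rowLen_eq_card]
    rfl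
  · rintro ⟨i, j⟩ hc
    have h1 : (i, j) ∈ μ := hc
    have h2 : (i, 0) ∈ μ := μ.up_left_mem le_rfl (Nat.zero_le j) h1
    rw [YoungDiagram.mem_iff_lt_colLen] at h2
    simp only [Finset.coe_range, Set.mem_Iio]
    exact h2.trans_le h

theorem rowLen_eq_zero {μ : YoungDiagram} {i : ℕ} (h : μ.colLen 0 ≤ i) : μ.rowLen i = 0 :=
  mem_lengthLE_iff.1 h

theorem nStat_eq_sum {k : ℕ} {μ : YoungDiagram} (h : μ ∈ lengthLE k) :
    nStat μ = ∑ i ∈ Finset.range k, (μ.rowLen i).choose 2 := by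
  rw [nStat, YoungDiagram.rowLens, List.map_map]
  have h1 : ((List.range (μ.colLen 0)).map ((fun x => x.choose 2) ∘ μ.rowLen)).sum =
      ∑ i ∈ Finset.range (μ.colLen 0), (μ.rowLen i).choose 2 := rfl
  rw [h1]
  apply Finset.sum_subset
  · intro i; simp only [Finset.mem_range]; intro hi; exact hi.trans_le h
  · intro i _ hi
    rw [rowLen_eq_zero (by simpa using hi)]
    rfl

theorem pochPart_eq_prod {K : Type*} [Field K] (a q : K) {k : ℕ} {μ : YoungDiagram}
    (h : μ ∈ lengthLE k) :
    pochPart a q μ = ∏ i ∈ Finset.range k, poch a q (μ.rowLen i - μ.rowLen (i + 1)) := by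
  have h1 : pochPart a q μ =
      ∏ i ∈ Finset.range (μ.colLen 0), poch a q (μ.rowLen i - μ.rowLen (i + 1)) := by
    rw [pochPart, ← Finset.Ico_succ_right_eq_Icc, Finset.prod_Ico_eq_prod_range]
    simp [part, add_comm]
  rw [h1]
  apply Finset.prod_subset
  · intro i; simp only [Finset.mem_range]; intro hi; exact hi.trans_le h
  · intro i _ hi
    rw [rowLen_eq_zero (by simpa using hi)]
    simp

/-- A column has length exactly i + 1 when its index lies in the interval from `μ.rowLen (i + 1)` to
`μ.rowLen i`. -/
theorem mult_transpose (μ : YoungDiagram) (i : ℕ) :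
    mult μ.transpose (i + 1) = μ.rowLen i - μ.rowLen (i + 1) := by
  rw [mult, YoungDiagram.rowLens, YoungDiagram.colLen_transpose]
  have h1 : ((List.range (μ.rowLen 0)).map μ.transpose.rowLen).count (i + 1) =
      ((Finset.range (μ.rowLen 0)).filter fun j => μ.colLen j = i + 1).card := by
    rw [List.count, List.countP_map, List.countP_eq_length_filter]
    simp only [Function.comp_def, YoungDiagram.rowLen_transpose]
    rfl
  rw [h1, ← Nat.card_Ico]
  congr 1
  ext j
  simp only [Finset.mem_filter, Finset.mem_range, Finset.mem_Ico]
  have e1 : i < μ.colLen j ↔ j < μ.rowLen i := by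
    rw [← YoungDiagram.mem_iff_lt_colLen, YoungDiagram.mem_iff_lt_rowLen]
  have e2 : i + 1 < μ.colLen j ↔ j < μ.rowLen (i + 1) := by
    rw [← YoungDiagram.mem_iff_lt_colLen, YoungDiagram.mem_iff_lt_rowLen]
  have := μ.rowLen_anti 0 i (Nat.zero_le i)
  omega

theorem rowLen_double (μ : YoungDiagram) (i : ℕ) : (double μ).rowLen i = 2 * μ.rowLen i := by
  apply rowLen_eq_of_forall
  intro j
  rw [double, YoungDiagram.mem_ofRowLens]
  simp only [List.length_map, YoungDiagram.length_rowLens, List.getElem_map,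
    YoungDiagram.get_rowLens]
  constructor
  · rintro ⟨h1, h2⟩
    exact h2
  · intro h
    refine ⟨?_, h⟩
    by_contra! h'
    rw [rowLen_eq_zero h'] at h
    omega

theorem double_mem_lengthLE {k : ℕ} {μ : YoungDiagram} (h : μ ∈ lengthLE k) :
    double μ ∈ lengthLE k := by
  rw [mem_lengthLE_iff] at h ⊢
  rw [rowLen_double, h]

end Diagrams

/-! ### Factorized terms and the eigenvalue equations -/

section Terms

variable {K : Type*} [Field K]

/-- The kernel `1 / (q²; q²)_N`. -/
def evenStep (q : K) (N : ℕ) : K := (poch (q ^ 2) (q ^ 2) N)⁻¹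

/-- The kernel `1 / (q²; q²)_{⌊N / 2⌋}`. -/
def parityStep (q : K) (N : ℕ) : K := (poch (q ^ 2) (q ^ 2) (N / 2))⁻¹

/-- The weight `z ^ j q ^ (2j choose 2)` of a part `j`. -/
def evenWeight (q z : K) (j : ℕ) : K := z ^ j * q ^ (2 * j).choose 2

/-- The weight `z ^ j q ^ (j choose 2)` of a part `j`. -/
def parityWeight (q z : K) (j : ℕ) : K := z ^ j * q ^ j.choose 2

/-- The reciprocal `1 / (q)_{2j}`. -/
def evenInit (q : K) (j : ℕ) : K := (poch q q (2 * j))⁻¹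

/-- The reciprocal `1 / (q)_j`. -/
def parityInit (q : K) (j : ℕ) : K := (poch q q j)⁻¹

theorem weight_eq (κ D v : ℕ → K) (s : ℕ) (f : ℕ → ℕ) :
    weight κ D v s f = (∏ i ∈ Finset.range (s + 1), D (f i)) *
      ((∏ i ∈ Finset.range s, κ (f i - f (i + 1))) * v (f s)) := by
  rw [weight, Finset.prod_range_succ', Finset.prod_mul_distrib]
  ring

theorem prod_evenWeight {q z : K} {k : ℕ} {μ : YoungDiagram} (h : μ ∈ lengthLE k) :
    ∏ i ∈ Finset.range k, evenWeight q z (μ.rowLen i) =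
      z ^ μ.card * q ^ nStat (double μ) := by
  rw [card_eq_sum_rowLen h, nStat_eq_sum (double_mem_lengthLE h)]
  simp only [evenWeight, Finset.prod_mul_distrib, Finset.prod_pow_eq_pow_sum, rowLen_double]

theorem prod_parityWeight {q z : K} {k : ℕ} {μ : YoungDiagram} (h : μ ∈ lengthLE k) :
    ∏ i ∈ Finset.range k, parityWeight q z (μ.rowLen i) = z ^ μ.card * q ^ nStat μ := by
  rw [card_eq_sum_rowLen h, nStat_eq_sum h]
  simp only [parityWeight, Finset.prod_mul_distrib, Finset.prod_pow_eq_pow_sum]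

theorem prod_Icc_one (g : ℕ → K) (s : ℕ) :
    ∏ i ∈ Finset.Icc 1 s, g i = ∏ i ∈ Finset.range s, g (i + 1) := by
  rw [← Finset.Ico_succ_right_eq_Icc, Finset.prod_Ico_eq_prod_range]
  simp [add_comm]

theorem cCoeff_eq (q : K) (s : ℕ) (μ : YoungDiagram) :
    cCoeff q (s + 1) (double μ).transpose =
      ∏ i ∈ Finset.range s, poch q (q ^ 2) (μ.rowLen i - μ.rowLen (i + 1)) := by
  rw [cCoeff, Nat.add_sub_cancel, prod_Icc_one]
  refine Finset.prod_congr rfl fun i _ => ?_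
  rw [mult_transpose, rowLen_double, rowLen_double]
  congr 1
  omega

theorem dCoeff_eq (q : K) (s : ℕ) (μ : YoungDiagram) :
    dCoeff q (s + 1) μ.transpose =
      ∏ i ∈ Finset.range s, poch q q (μ.rowLen i - μ.rowLen (i + 1)) *
        parityStep q (μ.rowLen i - μ.rowLen (i + 1)) := by
  rw [dCoeff, Nat.add_sub_cancel, prod_Icc_one]
  refine Finset.prod_congr rfl fun i _ => ?_
  rw [mult_transpose, parityStep, div_eq_mul_inv]

/-- For N = λ_i - λ_{i+1} the coefficient contributes (q;q²)_N, and (q)_{2N} = (q;q²)_N (q²;q²)_N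
leaves 1/(q²;q²)_N. Only i < k carry such a factor, so the last part keeps 1/(q)_{2λ_k}. -/
theorem cTerm_eq {s n : ℕ} {q z : K} {μ : YoungDiagram} (hμ : μ ∈ lengthLE (s + 1))
    (hq : poch q q n ≠ 0) :
    cTerm (s + 1) n q z μ = poch q q n * recipPoch q n (2 * μ.rowLen 0) *
      weight (evenStep q) (evenWeight q z) (evenInit q) s μ.rowLen := by
  rw [cTerm, qBinomPart, part, Nat.sub_self, rowLen_double]
  split_ifs with h
  · rw [weight_eq, prod_evenWeight hμ, recipPoch_of_le _ h, cCoeff_eq,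
      pochPart_eq_prod _ _ (double_mem_lengthLE hμ), Finset.prod_range_succ, rowLen_double,
      rowLen_double, mem_lengthLE_iff.1 hμ, mul_zero, Nat.sub_zero, evenInit]
    have h1 : ∏ i ∈ Finset.range s, evenStep q (μ.rowLen i - μ.rowLen (i + 1)) =
        (∏ i ∈ Finset.range s, poch q (q ^ 2) (μ.rowLen i - μ.rowLen (i + 1))) /
          ∏ i ∈ Finset.range s,
            poch q q ((double μ).rowLen i - (double μ).rowLen (i + 1)) := by
      rw [← Finset.prod_div_distrib]
      refine Finset.prod_congr rfl fun i _ => ?_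
      rw [rowLen_double, rowLen_double, ← Nat.mul_sub, evenStep]
      have h2 : poch q q (2 * (μ.rowLen i - μ.rowLen (i + 1))) ≠ 0 := by
        apply poch_ne_zero_of_le hq
        have := μ.rowLen_anti 0 i (Nat.zero_le i)
        omega
      rw [poch_two_mul] at h2 ⊢
      have h3 := left_ne_zero_of_mul h2
      rw [← sq, div_mul_eq_div_div, div_self h3, one_div]
    rw [h1]
    simp only [div_eq_mul_inv, mul_inv]
    ring
  · rw [recipPoch_of_lt _ (not_le.1 h)]
    simp

theorem dTerm_eq {s n : ℕ} {q z : K} {μ : YoungDiagram} (hμ : μ ∈ lengthLE (s + 1))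
    (hq : poch q q n ≠ 0) :
    dTerm (s + 1) n q z μ = poch q q n * recipPoch q n (μ.rowLen 0) *
      weight (parityStep q) (parityWeight q z) (parityInit q) s μ.rowLen := by
  rw [dTerm, qBinomPart, part, Nat.sub_self]
  split_ifs with h
  · rw [weight_eq, prod_parityWeight hμ, recipPoch_of_le _ h, dCoeff_eq,
      pochPart_eq_prod _ _ hμ, Finset.prod_range_succ, mem_lengthLE_iff.1 hμ, Nat.sub_zero,
      parityInit, Finset.prod_mul_distrib]
    have h1 : ∏ i ∈ Finset.range s, poch q q (μ.rowLen i - μ.rowLen (i + 1)) ≠ 0 := by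
      refine Finset.prod_ne_zero_iff.2 fun i _ => poch_ne_zero_of_le hq ?_
      have := μ.rowLen_anti 0 i (Nat.zero_le i)
      omega
    generalize ∏ i ∈ Finset.range s, poch q q (μ.rowLen i - μ.rowLen (i + 1)) = P at *
    generalize ∏ i ∈ Finset.range s, parityStep q (μ.rowLen i - μ.rowLen (i + 1)) = S at *
    simp only [div_eq_mul_inv, mul_inv]
    have h2 : P * P⁻¹ = 1 := mul_inv_cancel₀ h1
    linear_combination (S * z ^ μ.card * q ^ nStat μ * poch q q n *
      (poch q q (n - μ.rowLen 0))⁻¹ * (poch q q (μ.rowLen s))⁻¹) * h2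
  · rw [recipPoch_of_lt _ (not_le.1 h)]
    simp

theorem cLimTerm_eq {s : ℕ} {q z : ℂ} {μ : YoungDiagram} (hμ : μ ∈ lengthLE (s + 1)) :
    cLimTerm (s + 1) q z μ =
      weight (evenStep q) (evenWeight q z) (evenInit q) s μ.rowLen := by
  rw [cLimTerm, weight_eq, prod_evenWeight hμ, pochPart_eq_prod _ _ hμ, Finset.prod_range_succ,
    mem_lengthLE_iff.1 hμ, Nat.sub_zero, part, Nat.add_sub_cancel, evenInit, poch_two_mul]
  simp only [evenStep, Finset.prod_inv_distrib, div_eq_mul_inv, mul_inv, ← sq]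
  ring

theorem dLimTerm_eq {s : ℕ} {q z : ℂ} {μ : YoungDiagram} (hμ : μ ∈ lengthLE (s + 1)) :
    dLimTerm (s + 1) q z μ =
      weight (parityStep q) (parityWeight q z) (parityInit q) s μ.rowLen := by
  rw [dLimTerm, weight_eq, prod_parityWeight hμ, part, Nat.add_sub_cancel, parityInit,
    prod_Icc_one]
  simp only [parityStep, part, Nat.add_sub_cancel, Finset.prod_inv_distrib, div_eq_mul_inv,
    mul_inv]
  ring

theorem sum_Icc_eq_sum_range (F : ℕ → K) {r m : ℕ} (h : r ≤ m) :
    ∑ j ∈ Finset.Icc r m, F j = ∑ l ∈ Finset.range (m - r + 1), F (r + l) := by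
  rw [← Finset.Ico_succ_right_eq_Icc, Finset.sum_Ico_eq_sum_range]
  congr 2
  simp only [Order.succ_eq_add_one]
  omega

theorem choose_two_two_mul_add (r l : ℕ) :
    (2 * (r + l)).choose 2 = (2 * r).choose 2 + (2 * l).choose 2 + 4 * r * l := by
  induction l with
  | zero => simp
  | succ l ih =>
    rw [← add_assoc, choose_two_two_mul_succ, ih, choose_two_two_mul_succ]
    ring

theorem choose_two_add (r l : ℕ) : (r + l).choose 2 = r.choose 2 + l.choose 2 + r * l := by
  induction l with
  | zero => simp
  | succ l ih =>
    rw [← add_assoc, choose_two_succ, ih, choose_two_succ]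
    ring

theorem evenWeight_add (q z : K) (r l : ℕ) : evenWeight q z (r + l) =
    evenWeight q z r * ((z * q ^ (4 * r)) ^ l * q ^ (2 * l).choose 2) := by
  simp only [evenWeight, choose_two_two_mul_add, pow_add, mul_pow, ← pow_mul]
  ring

theorem parityWeight_add (q z : K) (r l : ℕ) : parityWeight q z (r + l) =
    parityWeight q z r * ((z * q ^ r) ^ l * q ^ l.choose 2) := by
  simp only [parityWeight, choose_two_add, pow_add, mul_pow, ← pow_mul]
  ring

theorem evenKernel_add (t q : K) (r l : ℕ) : evenKernel t q (r + l) r =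
    (poch (q ^ 2) (q ^ 2) l * poch (t * q ^ (4 * r + 2)) (q ^ 2) l)⁻¹ /
      poch (t * q ^ 2) (q ^ 2) (2 * r) := by
  rw [evenKernel, add_comm r l, recipPoch_add, show l + r + r = 2 * r + l by ring, poch_add,
    show t * q ^ 2 * (q ^ 2) ^ (2 * r) = t * q ^ (4 * r + 2) by ring]
  simp only [div_eq_mul_inv, mul_inv]
  ring

/-- The substitution j = r + l splits off the weight of r and turns z into z q^{4r}; what remains is
q-Vandermonde in base q² with b = t q^{4r+2}. -/
theorem evenKernel_eigen {t q : K} (hq0 : q ≠ 0) {r m : ℕ} (hrm : r ≤ m)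
    (hp : poch (q ^ 2) (q ^ 2) (m - r) ≠ 0)
    (hb : poch (t * q ^ (4 * r + 2)) (q ^ 2) (m - r) ≠ 0) :
    ∑ j ∈ Finset.Icc r m, evenStep q (m - j) * evenWeight q (t * q) j * evenKernel t q j r =
      evenWeight q (t * q) r * evenKernel t q m r := by
  obtain ⟨i, rfl⟩ := Nat.exists_eq_add_of_le hrm
  rw [Nat.add_sub_cancel_left] at hp hb
  rw [sum_Icc_eq_sum_range _ hrm, evenKernel_add, Nat.add_sub_cancel_left,
    ← sum_vandermonde (pow_ne_zero 2 hq0) i hp hb, Finset.sum_div, Finset.mul_sum]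
  refine Finset.sum_congr rfl fun l hl => ?_
  have hl' : l ≤ i := by rw [Finset.mem_range] at hl; omega
  rw [evenKernel_add, evenWeight_add, show r + i - (r + l) = i - l by omega, evenStep,
    ← recipPoch_of_le _ hl', show t * q ^ (4 * r + 2) = (t * q * q ^ (4 * r)) * q by ring,
    vandermondeTerm_sq]
  simp only [div_eq_mul_inv]
  ring

/-- The same shift reduces the last pairing to q-Gauss with u = t q^{4r+1} and N = n - 2r. -/
theorem evenKernel_gauss {t q : K} (hq0 : q ≠ 0) {r n : ℕ} (hrn : r ≤ n / 2)
    (hp : poch (q ^ 2) (q ^ 2) (n / 2 - r) ≠ 0)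
    (hb : poch (t * q ^ (4 * r + 2)) (q ^ 2) (n / 2 - r) ≠ 0)
    (hq : poch q q (n - 2 * r) ≠ 0) (hu : poch (t * q ^ (4 * r + 1)) q (n - 2 * r) ≠ 0) :
    ∑ j ∈ Finset.Icc r (n / 2), recipPoch q n (2 * j) * evenWeight q (t * q) j *
      evenKernel t q j r =
    evenWeight q (t * q) r * (poch (t * q ^ (4 * r + 1)) (q ^ 2) (n - 2 * r) /
      (poch q q (n - 2 * r) * poch (t * q ^ (4 * r + 1)) q (n - 2 * r)) /
        poch (t * q ^ 2) (q ^ 2) (2 * r)) := by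
  have e : t * q ^ (4 * r + 2) = t * q ^ (4 * r + 1) * q := by ring
  rw [e] at hb
  rw [← sum_gauss hq0 (n / 2 - r) hp hb (n - 2 * r) (by omega) hq hu,
    sum_Icc_eq_sum_range _ hrn, Finset.sum_div, Finset.mul_sum]
  refine Finset.sum_congr rfl fun l hl => ?_
  have e2 : recipPoch q n (2 * (r + l)) = recipPoch q (n - 2 * r) (2 * l) := by
    rw [Finset.mem_range] at hl
    rw [recipPoch_of_le _ (by omega), recipPoch_of_le _ (by omega)]
    congr 2
    omega
  rw [evenKernel_add, evenWeight_add, e2, gaussTerm, e]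
  simp only [div_eq_mul_inv, mul_inv]
  ring

theorem parityKernel_eigen {q z w : K} (hq0 : q ≠ 0) {r m : ℕ} (hrm : r ≤ m)
    (hw : w = z * q ^ r)
    (hp : poch (q ^ 2) (q ^ 2) ((m - r) / 2) ≠ 0)
    (hb : poch (w ^ 2 * q) (q ^ 2) ((m - r) / 2) ≠ 0) :
    ∑ j ∈ Finset.Icc r m, parityStep q (m - j) * parityWeight q z j *
        parityKernel w q (j - r) =
      parityWeight q z r * parityKernel w q (m - r) := by
  rw [sum_Icc_eq_sum_range _ hrm, ← sum_parityKernel_eigen hq0 (m - r) hp hb, Finset.mul_sum]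
  refine Finset.sum_congr rfl fun l _ => ?_
  rw [Nat.add_sub_cancel_left, parityWeight_add, ← hw, parityStep, Nat.sub_add_eq]
  ring

theorem parityKernel_gauss {q z w : K} (hq0 : q ≠ 0) {r n : ℕ} (hrn : r ≤ n)
    (hw : w = z * q ^ r) (hq : poch q q (n - r) ≠ 0)
    (hp : poch (q ^ 2) (q ^ 2) ((n - r) / 2) ≠ 0)
    (hb : poch (w ^ 2 * q) (q ^ 2) ((n - r) / 2) ≠ 0) (hw2 : poch (w ^ 2) q (n - r) ≠ 0) :
    ∑ j ∈ Finset.Icc r n, recipPoch q n j * parityWeight q z j * parityKernel w q (j - r) =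
      parityWeight q z r * ((1 - w * q ^ (n - r)) * (poch (w ^ 2) (q ^ 2) (n - r) /
        (poch q q (n - r) * poch (w ^ 2) q (n - r)))) := by
  rw [sum_Icc_eq_sum_range _ hrn, ← sum_parityKernel_gauss hq0 (n - r) hq hp hb hw2,
    Finset.mul_sum]
  refine Finset.sum_congr rfl fun l hl => ?_
  have e2 : recipPoch q n (r + l) = recipPoch q (n - r) l := by
    rw [Finset.mem_range] at hl
    rw [recipPoch_of_le _ (by omega), recipPoch_of_le _ (by omega)]
    congr 2
    omega
  rw [Nat.add_sub_cancel_left, parityWeight_add, ← hw, e2]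
  ring

end Terms

/-! ### The finite identities over a field -/

section FiniteTheorem

variable {K : Type*} [Field K]

/-- (q²;q²)_i divides (q)_{2i}, so the base q² denominators need no hypothesis beyond (q)_n ≠ 0. -/
theorem poch_sq_ne_zero {q : K} {n i : ℕ} (hq : poch q q n ≠ 0) (hi : 2 * i ≤ n) :
    poch (q ^ 2) (q ^ 2) i ≠ 0 := by
  have := poch_ne_zero_of_le hq hi
  rw [poch_two_mul, ← sq] at this
  exact right_ne_zero_of_mul this

theorem evenCoeff_match {t q : K} {r N : ℕ} (ht : 1 - t ≠ 0)
    (h1 : poch (t * q ^ (2 * r)) q (2 * r + 1) ≠ 0)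
    (h2 : poch (t * q ^ 2) (q ^ 2) (2 * r) ≠ 0) :
    poch (t * q) (q ^ 2) (2 * r + N) * ((1 - t * q ^ (4 * r)) /
      poch (t * q ^ (2 * r)) q (2 * r + 1 + N)) =
    poch t q (2 * r) * (1 - t * q ^ (4 * r)) / (1 - t) *
      (poch (t * q ^ (4 * r + 1)) (q ^ 2) N / poch (t * q ^ (4 * r + 1)) q N /
        poch (t * q ^ 2) (q ^ 2) (2 * r)) := by
  -- Both sides are (t;q)_{4r+1}: split by parity of the exponent on the left, at exponent 2r on the
  -- right.
  have e1 : poch (t * q) (q ^ 2) (2 * r) * poch (t * q ^ 2) (q ^ 2) (2 * r) * (1 - t) =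
      poch t q (2 * r) * poch (t * q ^ (2 * r)) q (2 * r + 1) := by
    rw [← poch_add, show 2 * r + (2 * r + 1) = 2 * (2 * r) + 1 by ring, poch_succ',
      poch_two_mul (t * q) q (2 * r), show t * q * q = t * q ^ 2 by ring]
    ring
  rw [poch_add _ _ (2 * r) N, poch_add _ _ (2 * r + 1) N,
    show t * q * (q ^ 2) ^ (2 * r) = t * q ^ (4 * r + 1) by ring,
    show t * q ^ (2 * r) * q ^ (2 * r + 1) = t * q ^ (4 * r + 1) by ring]
  have e2 : poch (t * q) (q ^ 2) (2 * r) / poch (t * q ^ (2 * r)) q (2 * r + 1) =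
      poch t q (2 * r) / ((1 - t) * poch (t * q ^ 2) (q ^ 2) (2 * r)) := by
    rw [div_eq_div_iff h1 (mul_ne_zero ht h2), ← e1]
    ring
  simp only [div_eq_mul_inv, mul_inv] at e2 ⊢
  linear_combination (poch (t * q ^ (4 * r + 1)) (q ^ 2) N * (1 - t * q ^ (4 * r)) *
    (poch (t * q ^ (4 * r + 1)) q N)⁻¹) * e2

theorem parityCoeff_match {t q : K} {r N : ℕ}
    (h2 : poch (t ^ 2 * q) q r ≠ 0) (h3 : 1 - t ^ 2 * q ^ (2 * r + 1) ≠ 0) :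
    poch ((t * q) ^ 2) (q ^ 2) (r + N) * (((1 - t) * (1 - t ^ 2 * q ^ (2 * r + 1)) *
        (1 - t * q ^ (r + N + 1))) / ((1 - t * q ^ r) * (1 - t * q ^ (r + 1)) *
          poch (t ^ 2 * q ^ (r + 1)) q (r + 1 + N))) * q ^ (r + r.choose 2) / poch q q r =
    parityCoeff t q r * ((1 - t * q ^ (r + 1) * q ^ N) *
      (poch ((t * q ^ (r + 1)) ^ 2) (q ^ 2) N / poch ((t * q ^ (r + 1)) ^ 2) q N)) := by
  rw [parityCoeff, poch_add _ _ r N, poch_add _ _ (r + 1) N, poch_succ, two_mul r,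
    poch_add (t ^ 2 * q) _ r r, choose_two_succ,
    show (t * q) ^ 2 * (q ^ 2) ^ r = (t * q ^ (r + 1)) ^ 2 by ring,
    show t ^ 2 * q ^ (r + 1) * q ^ (r + 1) = (t * q ^ (r + 1)) ^ 2 by ring,
    show t ^ 2 * q * q ^ r = t ^ 2 * q ^ (r + 1) by ring,
    show t ^ 2 * q ^ (r + 1) * q ^ r = t ^ 2 * q ^ (2 * r + 1) by ring,
    show t * q ^ (r + N + 1) = t * q ^ (r + 1) * q ^ N by ring, mul_pow t q 2,
    show r + r = 2 * r by ring, add_comm r (r.choose 2)]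
  simp only [div_eq_mul_inv, mul_inv]
  have e2 := mul_inv_cancel₀ h2
  have e3 := mul_inv_cancel₀ h3
  generalize poch (t ^ 2 * q) q r = a at *
  generalize 1 - t ^ 2 * q ^ (2 * r + 1) = b at *
  generalize poch (t ^ 2 * q ^ 2) (q ^ 2) r = c1
  generalize poch ((t * q ^ (r + 1)) ^ 2) (q ^ 2) N = c2
  generalize (poch ((t * q ^ (r + 1)) ^ 2) q N)⁻¹ = c3
  generalize (poch (t ^ 2 * q ^ (r + 1)) q r)⁻¹ = c4
  generalize (poch q q r)⁻¹ = c5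
  generalize (1 - t * q ^ r)⁻¹ = c6
  generalize (1 - t * q ^ (r + 1))⁻¹ = c7
  generalize q ^ (r.choose 2 + r) = c8
  generalize 1 - t * q ^ (r + 1) * q ^ N = c9
  linear_combination c1 * c2 * c3 * c4 * c5 * c6 * c7 * c8 * c9 * (1 - t) * (e3 - e2)

theorem sum_cTerm (s n : ℕ) {q z : K} (hq0 : q ≠ 0) (hq : poch q q n ≠ 0)
    (hz : ∀ r : ℕ, 2 * r ≤ n → poch (z * q ^ (2 * (r : ℤ) - 1)) q (n + 1) ≠ 0) :
    {μ ∈ lengthLE (s + 1) | cTerm (s + 1) n q z μ ≠ 0}.Finite ∧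
      ∑ᶠ μ ∈ lengthLE (s + 1), cTerm (s + 1) n q z μ = cClosed (s + 1) n q z := by
  -- With t = z/q all integer exponents become natural numbers.
  obtain ⟨t, rfl⟩ : ∃ t, z = t * q := ⟨z / q, by field_simp⟩
  have ez : ∀ r : ℕ, t * q * q ^ (2 * (r : ℤ) - 1) = t * q ^ (2 * r) := fun r => by
    rw [mul_assoc, ← zpow_one_add₀ hq0, show 1 + (2 * (r : ℤ) - 1) = ((2 * r : ℕ) : ℤ) by
      push_cast; ring, zpow_natCast]
  have ez' : ∀ r : ℕ, t * q * q ^ (4 * (r : ℤ) - 1) = t * q ^ (4 * r) := fun r => by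
    rw [mul_assoc, ← zpow_one_add₀ hq0, show 1 + (4 * (r : ℤ) - 1) = ((4 * r : ℕ) : ℤ) by
      push_cast; ring, zpow_natCast]
  simp only [ez] at hz
  -- The r-th denominator covers the exponents from 2r to 2r + n; r = 0 and r = ⌊n/2⌋ together cover
  -- the whole range, which contains every factor divided by below.
  have ht : ∀ i ≤ 2 * (n / 2) + n, 1 - t * q ^ i ≠ 0 := by
    intro i hi
    obtain ⟨r, j, hr, hj, rfl⟩ : ∃ r j, 2 * r ≤ n ∧ j < n + 1 ∧ i = 2 * r + j := by
      by_cases h : i ≤ n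
      · exact ⟨0, i, by omega, by omega, by omega⟩
      · exact ⟨n / 2, i - 2 * (n / 2), by omega, by omega, by omega⟩
    have := poch_ne_zero_iff.1 (hz r hr) j hj
    rwa [mul_assoc, ← pow_add] at this
  have hpoch : ∀ a i, a + i ≤ 2 * (n / 2) + n + 1 → poch (t * q ^ a) q i ≠ 0 := by
    intro a i hi
    refine poch_ne_zero_iff.2 fun j hj => ?_
    rw [mul_assoc, ← pow_add]
    exact ht _ (by omega)
  have hpoch2 : ∀ a i, a + 2 * i ≤ 2 * (n / 2) + n + 2 → poch (t * q ^ a) (q ^ 2) i ≠ 0 := by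
    intro a i hi
    refine poch_ne_zero_iff.2 fun j hj => ?_
    rw [mul_assoc, ← pow_mul, ← pow_add]
    exact ht _ (by omega)
  have ht0 : 1 - t ≠ 0 := by simpa using ht 0 (by omega)
  have hfs := finsum_lengthLE (k := s + 1) (n := n / 2) (T := cTerm (s + 1) n q (t * q))
    (F := fun f => poch q q n * recipPoch q n (2 * f 0) *
      weight (evenStep q) (evenWeight q (t * q)) (evenInit q) s f)
    (fun μ hμ => cTerm_eq hμ hq)
    (fun μ hμ h => by rw [cTerm_eq hμ hq, recipPoch_of_lt _ (by omega)]; ring)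
  refine ⟨hfs.1, hfs.2.trans ?_⟩
  rw [sum_boxed_weight _ _ _ (fun m => poch q q n * recipPoch q n (2 * m)),
    sum_chain_eigen (α := evenCoeff t q) (M := evenKernel t q)
      (N := fun r => poch q q n * (poch (t * q ^ (4 * r + 1)) (q ^ 2) (n - 2 * r) /
      (poch q q (n - 2 * r) * poch (t * q ^ (4 * r + 1)) q (n - 2 * r)) /
        poch (t * q ^ 2) (q ^ 2) (2 * r)))]
  · rw [cClosed, Finset.mul_sum]
    have hext : ∀ F : ℕ → K, (∀ r, n < 2 * r → F r = 0) →
        ∑ r ∈ Finset.range (n + 1), F r = ∑ r ∈ Finset.range (n / 2 + 1), F r := by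
      intro F hF
      symm
      apply Finset.sum_subset
      · intro r; simp only [Finset.mem_range]; omega
      · intro r _ hr
        exact hF r (by simp only [Finset.mem_range] at hr; omega)
    rw [hext]
    · refine Finset.sum_congr rfl fun r hr => ?_
      have hr' : 2 * r ≤ n := by rw [Finset.mem_range] at hr; omega
      obtain ⟨N, rfl⟩ := Nat.exists_eq_add_of_le hr'
      have hm := evenCoeff_match (N := N) ht0 (hpoch (2 * r) (2 * r + 1) (by omega))
        (hpoch2 2 (2 * r) (by omega))
      rw [ez, ez', qBinom_eq, show 2 * r + N + 1 = 2 * r + 1 + N by ring, recipPoch_of_le _ hr', evenCoeff, evenWeight,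
        Nat.add_sub_cancel_left]
      have e : (q ^ ((s + 1 + 1) * (2 * r).choose 2) : K) =
          q ^ (2 * r).choose 2 * (q ^ (2 * r).choose 2) ^ (s + 1) := by ring
      rw [e, mul_pow, ← pow_mul, mul_comm (s + 1) r]
      simp only [div_eq_mul_inv, mul_inv] at hm ⊢
      linear_combination (-(t * q) ^ (r * (s + 1)) * (q ^ (2 * r).choose 2 *
        (q ^ (2 * r).choose 2) ^ (s + 1)) * poch q q (2 * r + N) * (poch q q N)⁻¹ *
          (poch q q (2 * r))⁻¹) * hm
    · intro r hr
      rw [qBinom_eq, recipPoch_of_lt _ hr]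
      ring
  · intro r m hrm hm
    exact evenKernel_eigen hq0 hrm (poch_sq_ne_zero hq (by omega)) (hpoch2 _ _ (by omega))
  · intro m hm
    exact sum_evenCoeff hq0 ht0 m (poch_ne_zero_of_le hq (by omega))
      (poch_sq_ne_zero hq (by omega)) (hpoch2 _ _ (by omega))
  · intro r hr
    have := evenKernel_gauss (t := t) hq0 hr (poch_sq_ne_zero hq (by omega))
      (hpoch2 _ _ (by omega)) (poch_ne_zero_of_le hq (by omega)) (hpoch _ _ (by omega))
    simp only [mul_assoc (poch q q n)]
    rw [← Finset.mul_sum, ← mul_assoc _ (poch q q n), mul_comm _ (poch q q n), mul_assoc, ← this]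

theorem sum_dTerm (s n : ℕ) {q z : K} (hq0 : q ≠ 0) (hq : poch q q n ≠ 0)
    (hz : ∀ r : ℕ, r ≤ n → (1 - z * q ^ ((r : ℤ) - 1)) * (1 - z * q ^ r) *
      poch (z ^ 2 * q ^ ((r : ℤ) - 1)) q (n + 1) ≠ 0) :
    {μ ∈ lengthLE (s + 1) | dTerm (s + 1) n q z μ ≠ 0}.Finite ∧
      ∑ᶠ μ ∈ lengthLE (s + 1), dTerm (s + 1) n q z μ = dClosed (s + 1) n q z := by
  obtain ⟨t, rfl⟩ : ∃ t, z = t * q := ⟨z / q, by field_simp⟩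
  have ez : ∀ r : ℕ, t * q * q ^ ((r : ℤ) - 1) = t * q ^ r := fun r => by
    rw [mul_assoc, ← zpow_one_add₀ hq0, show 1 + ((r : ℤ) - 1) = (r : ℤ) by ring, zpow_natCast]
  have ez0 : t * q * q ^ (-1 : ℤ) = t := by
    rw [mul_assoc, ← zpow_one_add₀ hq0]; simp
  have ez1 : ∀ r : ℕ, (t * q) ^ 2 * q ^ ((r : ℤ) - 1) = t ^ 2 * q ^ (r + 1) := fun r => by
    rw [sq (t * q), mul_assoc, ez]
    ring
  have ez2 : ∀ r : ℕ, (t * q) ^ 2 * q ^ (2 * (r : ℤ) - 1) = t ^ 2 * q ^ (2 * r + 1) := fun r => by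
    have := ez1 (2 * r)
    push_cast at this
    exact this
  have ez3 : ∀ r : ℕ, t * q * q ^ r = t * q ^ (r + 1) := fun r => by ring
  simp only [ez, ez1, ez3] at hz
  have ht : ∀ i ≤ n + 1, 1 - t * q ^ i ≠ 0 := by
    intro i hi
    rcases i with _ | i
    · exact left_ne_zero_of_mul (left_ne_zero_of_mul (hz 0 (by omega)))
    · exact right_ne_zero_of_mul (left_ne_zero_of_mul (hz i (by omega)))
  -- The exponents start at 1 since t² = 1 is not excluded by the hypotheses. The cases r = 0 and r
  -- = n cover the range.
  have ht2 : ∀ i, 1 ≤ i → i ≤ 2 * n + 1 → 1 - t ^ 2 * q ^ i ≠ 0 := by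
    intro i hi hi'
    obtain ⟨r, j, hr, hj, rfl⟩ : ∃ r j, r ≤ n ∧ j < n + 1 ∧ i = r + 1 + j := by
      by_cases h : i ≤ n + 1
      · exact ⟨0, i - 1, by omega, by omega, by omega⟩
      · exact ⟨n, i - 1 - n, by omega, by omega, by omega⟩
    have := poch_ne_zero_iff.1 (right_ne_zero_of_mul (hz r hr)) j hj
    rwa [mul_assoc, ← pow_add] at this
  have hpoch : ∀ a i, 1 ≤ a → a + i ≤ 2 * n + 2 → poch (t ^ 2 * q ^ a) q i ≠ 0 := by
    intro a i ha hi
    refine poch_ne_zero_iff.2 fun j hj => ?_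
    rw [mul_assoc, ← pow_add]
    exact ht2 _ (by omega) (by omega)
  have hpoch2 : ∀ a i, 1 ≤ a → a + 2 * i ≤ 2 * n + 3 → poch (t ^ 2 * q ^ a) (q ^ 2) i ≠ 0 := by
    intro a i ha hi
    refine poch_ne_zero_iff.2 fun j hj => ?_
    rw [mul_assoc, ← pow_mul, ← pow_add]
    exact ht2 _ (by omega) (by omega)
  have hw : ∀ r, t * q ^ (r + 1) = t * q * q ^ r := fun r => by ring
  have hw2 : ∀ r, (t * q ^ (r + 1)) ^ 2 = t ^ 2 * q ^ (2 * r + 2) := fun r => by ring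
  have hw3 : ∀ r, (t * q ^ (r + 1)) ^ 2 * q = t ^ 2 * q ^ (2 * r + 3) := fun r => by ring
  have hfs := finsum_lengthLE (k := s + 1) (n := n) (T := dTerm (s + 1) n q (t * q))
    (F := fun f => poch q q n * recipPoch q n (f 0) *
      weight (parityStep q) (parityWeight q (t * q)) (parityInit q) s f)
    (fun μ hμ => dTerm_eq hμ hq)
    (fun μ hμ h => by rw [dTerm_eq hμ hq, recipPoch_of_lt _ (by omega)]; ring)
  refine ⟨hfs.1, hfs.2.trans ?_⟩
  rw [sum_boxed_weight _ _ _ (fun m => poch q q n * recipPoch q n m),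
    sum_chain_eigen (α := parityCoeff t q) (M := fun m r => parityKernel (t * q ^ (r + 1)) q (m - r))
      (N := fun r => poch q q n * ((1 - t * q ^ (r + 1) * q ^ (n - r)) *
        (poch ((t * q ^ (r + 1)) ^ 2) (q ^ 2) (n - r) /
        (poch q q (n - r) * poch ((t * q ^ (r + 1)) ^ 2) q (n - r)))))]
  · rw [dClosed, Finset.mul_sum]
    refine Finset.sum_congr rfl fun r hr => ?_
    have hr' : r ≤ n := by rw [Finset.mem_range] at hr; omega
    obtain ⟨N, rfl⟩ := Nat.exists_eq_add_of_le hr'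
    have e0 : t ^ 2 * q = t ^ 2 * q ^ 1 := by ring
    have hm := parityCoeff_match (t := t) (N := N) (r := r)
      (by rw [e0]; exact hpoch 1 r (by omega) (by omega)) (ht2 _ (by omega) (by omega))
    rw [ez, ez0, ez1, ez2, ez3, ez3, qBinom_eq, show r + N + 1 = r + 1 + N by ring,
      recipPoch_of_le _ hr', parityWeight, Nat.add_sub_cancel_left]
    rw [show r + N + 1 = r + 1 + N by ring] at hm
    have e : (q ^ (r + (s + 1 + 1) * r.choose 2) : K) =
        q ^ (r + r.choose 2) * (q ^ r.choose 2) ^ (s + 1) := by ring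
    rw [e, mul_pow, ← pow_mul, mul_comm (s + 1) r]
    simp only [div_eq_mul_inv, mul_inv] at hm ⊢
    linear_combination (-(t * q) ^ (r * (s + 1)) * (q ^ r.choose 2) ^ (s + 1) *
      poch q q (r + N) * (poch q q N)⁻¹) * hm
  · intro r m hrm hm
    exact parityKernel_eigen hq0 hrm (hw r) (poch_sq_ne_zero hq (by omega))
      (by rw [hw3]; exact hpoch2 _ _ (by omega) (by omega))
  · intro m hm
    refine sum_parityCoeff m (poch_ne_zero_of_le hq hm) (fun i hi => ht i (by omega)) ?_
      (fun i hi => poch_sq_ne_zero hq (by omega))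
    rw [show t ^ 2 * q = t ^ 2 * q ^ 1 by ring]
    exact hpoch _ _ le_rfl (by omega)
  · intro r hr
    have := parityKernel_gauss (n := n) (z := t * q) hq0 hr (hw r)
      (poch_ne_zero_of_le hq (by omega)) (poch_sq_ne_zero hq (by omega))
      (by rw [hw3]; exact hpoch2 _ _ (by omega) (by omega))
      (by rw [hw2]; exact hpoch _ _ (by omega) (by omega))
    simp only [mul_assoc (poch q q n)]
    rw [← Finset.mul_sum, ← mul_assoc _ (poch q q n), mul_comm _ (poch q q n), mul_assoc, ← this]

end FiniteTheorem

/-! ### Dominated convergence as n → ∞ -/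

section Limits

theorem exists_norm_le_of_tendsto {u : ℕ → ℂ} {a : ℂ} (h : Tendsto u atTop (𝓝 a)) :
    ∃ C, ∀ n, ‖u n‖ ≤ C := by
  obtain ⟨C, hC⟩ := (Metric.isBounded_range_of_tendsto u h).exists_norm_le
  exact ⟨C, fun n => hC _ ⟨n, rfl⟩⟩

theorem summable_norm_mul_pow {q : ℂ} (hq : ‖q‖ < 1) (a : ℂ) :
    Summable fun i : ℕ => ‖-(a * q ^ i)‖ := by
  simp only [norm_neg, norm_mul, norm_pow]
  exact (summable_geometric_of_lt_one (norm_nonneg q) hq).mul_left _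

theorem tendsto_poch {q : ℂ} (hq : ‖q‖ < 1) (a : ℂ) :
    Tendsto (poch a q) atTop (𝓝 (pochInf a q)) := by
  have := (multipliable_one_add_of_summable (summable_norm_mul_pow hq a)).tendsto_prod_tprod_nat
  simp only [← sub_eq_add_neg] at this
  exact this

theorem pochInf_ne_zero {q a : ℂ} (hq : ‖q‖ < 1) (ha : ∀ i : ℕ, 1 - a * q ^ i ≠ 0) :
    pochInf a q ≠ 0 := by
  have := tprod_one_add_ne_zero_of_summable (f := fun i : ℕ => -(a * q ^ i))
    (fun i => by rw [← sub_eq_add_neg]; exact ha i) (summable_norm_mul_pow hq a)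
  simp only [← sub_eq_add_neg] at this
  exact this

theorem exists_norm_poch_le {q : ℂ} (hq : ‖q‖ < 1) (a : ℂ) : ∃ C, ∀ n, ‖poch a q n‖ ≤ C :=
  exists_norm_le_of_tendsto (tendsto_poch hq a)

theorem exists_norm_poch_inv_le {q a : ℂ} (hq : ‖q‖ < 1) (ha : ∀ i : ℕ, 1 - a * q ^ i ≠ 0) :
    ∃ C, ∀ n, ‖(poch a q n)⁻¹‖ ≤ C :=
  exists_norm_le_of_tendsto ((tendsto_poch hq a).inv₀ (pochInf_ne_zero hq ha))

theorem one_sub_mul_pow_self_ne_zero {q : ℂ} (hq : ‖q‖ < 1) (i : ℕ) : 1 - q * q ^ i ≠ 0 := by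
  rw [← pow_succ', sub_ne_zero]
  intro h
  have h1 : ‖q ^ (i + 1)‖ < 1 := by
    rw [norm_pow]
    exact pow_lt_one₀ (norm_nonneg q) hq (by omega)
  rw [← h, norm_one] at h1
  exact lt_irrefl _ h1

theorem norm_sq_lt_one {q : ℂ} (hq : ‖q‖ < 1) : ‖q ^ 2‖ < 1 := by
  rw [norm_pow]
  exact pow_lt_one₀ (norm_nonneg q) hq (by omega)

theorem poch_self_ne_zero {q : ℂ} (hq : ‖q‖ < 1) (n : ℕ) : poch q q n ≠ 0 :=
  poch_ne_zero_iff.2 fun i _ => one_sub_mul_pow_self_ne_zero hq i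

theorem tendsto_recipPoch {q : ℂ} (hq : ‖q‖ < 1) (l : ℕ) :
    Tendsto (fun n => recipPoch q n l) atTop (𝓝 (pochInf q q)⁻¹) := by
  rw [← tendsto_add_atTop_iff_nat l]
  simp only [recipPoch_add]
  exact (tendsto_poch hq q).inv₀ (pochInf_ne_zero hq (one_sub_mul_pow_self_ne_zero hq))

theorem exists_norm_recipPoch_le {q : ℂ} (hq : ‖q‖ < 1) :
    ∃ C, ∀ n l, ‖recipPoch q n l‖ ≤ C := by
  obtain ⟨C, hC⟩ := exists_norm_poch_inv_le hq (one_sub_mul_pow_self_ne_zero hq)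
  refine ⟨C, fun n l => ?_⟩
  rw [recipPoch]
  split_ifs
  · exact hC _
  · rw [norm_zero]
    exact (norm_nonneg _).trans (hC 0)

theorem tendsto_poch_mul_recipPoch {q : ℂ} (hq : ‖q‖ < 1) (l : ℕ) :
    Tendsto (fun n => poch q q n * recipPoch q n l) atTop (𝓝 1) := by
  have := (tendsto_poch hq q).mul (tendsto_recipPoch hq l)
  rwa [mul_inv_cancel₀ (pochInf_ne_zero hq (one_sub_mul_pow_self_ne_zero hq))] at this

theorem exists_norm_poch_mul_recipPoch_le {q : ℂ} (hq : ‖q‖ < 1) :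
    ∃ C, 0 ≤ C ∧ ∀ n l, ‖poch q q n * recipPoch q n l‖ ≤ C := by
  obtain ⟨C, hC⟩ := exists_norm_recipPoch_le hq
  obtain ⟨C', hC'⟩ := exists_norm_poch_le hq q
  have h0 : 0 ≤ C := (norm_nonneg _).trans (hC 0 0)
  have h0' : 0 ≤ C' := (norm_nonneg _).trans (hC' 0)
  refine ⟨C' * C, by positivity, fun n l => ?_⟩
  rw [norm_mul]
  exact mul_le_mul (hC' n) (hC n l) (norm_nonneg _) h0'

theorem summable_tendsto_tsum_of_norm_le {β : Type*} {f : ℕ → β → ℂ} {g : β → ℂ}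
    {bound : β → ℝ} (hs : Summable bound) (hab : ∀ k, Tendsto (fun n => f n k) atTop (𝓝 (g k)))
    (hb : ∀ n k, ‖f n k‖ ≤ bound k) :
    Summable g ∧ Tendsto (fun n => ∑' k, f n k) atTop (𝓝 (∑' k, g k)) :=
  ⟨hs.of_norm_bounded fun k => le_of_tendsto' (hab k).norm fun n => hb n k,
    tendsto_tsum_of_dominated_convergence hs hab (Eventually.of_forall hb)⟩

/-- The ratio of consecutive terms is x ρ^j, which tends to 0, so x may be arbitrarily large; this
is why the series converge without a bound on |z|. -/
theorem summable_pow_mul_pow_choose {x ρ : ℝ} (hx : 0 ≤ x) (hρ0 : 0 ≤ ρ) (hρ : ρ < 1) :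
    Summable fun j : ℕ => x ^ j * ρ ^ j.choose 2 := by
  apply summable_of_ratio_norm_eventually_le (r := 1 / 2) (by norm_num)
  have h : Tendsto (fun j : ℕ => x * ρ ^ j) atTop (𝓝 (x * 0)) :=
    (tendsto_pow_atTop_nhds_zero_of_lt_one hρ0 hρ).const_mul x
  rw [mul_zero] at h
  filter_upwards [h.eventually_le_const (show (0 : ℝ) < 1 / 2 by norm_num)] with j hj
  rw [Real.norm_of_nonneg (by positivity), Real.norm_of_nonneg (by positivity), choose_two_succ]
  calc x ^ (j + 1) * ρ ^ (j.choose 2 + j) = (x * ρ ^ j) * (x ^ j * ρ ^ j.choose 2) := by ring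
    _ ≤ 1 / 2 * (x ^ j * ρ ^ j.choose 2) := by gcongr

theorem summable_fin_prod {a : ℕ → ℝ} (ha : Summable a) (h0 : ∀ j, 0 ≤ a j) (k : ℕ) :
    Summable fun x : Fin k → ℕ => ∏ i, a (x i) := by
  induction k with
  | zero => exact (hasSum_fintype _).summable
  | succ k ih =>
    rw [← (Fin.consEquiv fun _ : Fin (k + 1) => ℕ).summable_iff]
    have := ha.mul_of_nonneg ih h0 fun x => Finset.prod_nonneg fun i _ => h0 _
    refine this.congr fun x => ?_
    simp [Fin.consEquiv, Fin.prod_univ_succ]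

/-- Partitions with at most k parts inject into k-tuples of naturals, where the product majorant is
summable. -/
theorem summable_lengthLE {a : ℕ → ℝ} (ha : Summable a) (h0 : ∀ j, 0 ≤ a j) (k : ℕ) :
    Summable fun μ : lengthLE k =>
      ∏ i ∈ Finset.range k, a ((μ : YoungDiagram).rowLen i) := by
  have hinj : Function.Injective fun (μ : lengthLE k) (i : Fin k) =>
      (μ : YoungDiagram).rowLen i := by
    intro μ ν h
    apply Subtype.ext
    apply rowLen_injective
    funext i
    by_cases hi : i < k
    · exact congrFun h ⟨i, hi⟩
    · rw [rowLen_eq_zero (le_trans μ.2 (not_lt.1 hi)),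
        rowLen_eq_zero (le_trans ν.2 (not_lt.1 hi))]
  refine ((summable_fin_prod ha h0 k).comp_injective hinj).congr fun μ => ?_
  simp only [Function.comp_def]
  exact (Finset.prod_range fun i => a ((μ : YoungDiagram).rowLen i)).symm

theorem norm_weight_le {κ D v : ℕ → ℂ} {C C' : ℝ} (hκ : ∀ j, ‖κ j‖ ≤ C) (hv : ∀ j, ‖v j‖ ≤ C')
    (s : ℕ) (f : ℕ → ℕ) :
    ‖weight κ D v s f‖ ≤ (∏ i ∈ Finset.range (s + 1), ‖D (f i)‖) * (C ^ s * C') := by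
  rw [weight_eq, norm_mul, norm_mul, norm_prod, norm_prod]
  have h0 : 0 ≤ C := (norm_nonneg _).trans (hκ 0)
  gcongr
  · calc ∏ i ∈ Finset.range s, ‖κ (f i - f (i + 1))‖ ≤ ∏ _i ∈ Finset.range s, C :=
          Finset.prod_le_prod (fun _ _ => norm_nonneg _) fun _ _ => hκ _
      _ = C ^ s := by simp
  · exact hv _

/-- Only the factor (q)_n/(q)_{n-l(λ_1)} depends on n. It tends to 1 and is bounded uniformly in n
and λ, while κ and v are bounded, so a constant times ∏ |D(λ_i)| dominates. -/
theorem tendsto_finsum_weight {q : ℂ} (hq : ‖q‖ < 1) {κ D v : ℕ → ℂ} {C C' : ℝ}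
    (hκ : ∀ j, ‖κ j‖ ≤ C) (hv : ∀ j, ‖v j‖ ≤ C') (hD : Summable fun j => ‖D j‖) (s : ℕ)
    (l : ℕ → ℕ) {T : ℕ → YoungDiagram → ℂ} {G : YoungDiagram → ℂ}
    (hT : ∀ n, ∀ μ ∈ lengthLE (s + 1), T n μ =
      poch q q n * recipPoch q n (l (μ.rowLen 0)) * weight κ D v s μ.rowLen)
    (hG : ∀ μ ∈ lengthLE (s + 1), G μ = weight κ D v s μ.rowLen)
    (hfin : ∀ n, {μ ∈ lengthLE (s + 1) | T n μ ≠ 0}.Finite) :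
    Summable (fun μ : lengthLE (s + 1) => G μ) ∧
      Tendsto (fun n => ∑ᶠ μ ∈ lengthLE (s + 1), T n μ) atTop
        (𝓝 (∑' μ : lengthLE (s + 1), G μ)) := by
  obtain ⟨B, hB0, hB⟩ := exists_norm_poch_mul_recipPoch_le hq
  have hsum : ∀ n, ∑ᶠ μ ∈ lengthLE (s + 1), T n μ = ∑' μ : lengthLE (s + 1), T n μ := by
    intro n
    rw [← finsum_set_coe_eq_finsum_mem, tsum_eq_finsum]
    refine Set.Finite.of_finite_image ((hfin n).subset ?_) Subtype.val_injective.injOn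
    rintro _ ⟨μ, hμ, rfl⟩
    exact ⟨μ.2, hμ⟩
  simp only [hsum]
  refine summable_tendsto_tsum_of_norm_le
    (bound := fun μ : lengthLE (s + 1) => B *
      ((∏ i ∈ Finset.range (s + 1), ‖D ((μ : YoungDiagram).rowLen i)‖) * (C ^ s * C')))
    (((summable_lengthLE hD (fun j => norm_nonneg _) (s + 1)).mul_right _).mul_left _) ?_ ?_
  · intro μ
    simp only [hT _ _ μ.2, hG _ μ.2]
    have := (tendsto_poch_mul_recipPoch hq (l ((μ : YoungDiagram).rowLen 0))).mul_const
      (weight κ D v s (μ : YoungDiagram).rowLen)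
    rwa [one_mul] at this
  · intro n μ
    rw [hT _ _ μ.2, norm_mul]
    exact mul_le_mul (hB _ _) (norm_weight_le hκ hv s _) (norm_nonneg _) hB0

theorem summable_norm_parityWeight {q : ℂ} (hq : ‖q‖ < 1) (z : ℂ) :
    Summable fun j => ‖parityWeight q z j‖ := by
  simp only [parityWeight, norm_mul, norm_pow]
  exact summable_pow_mul_pow_choose (norm_nonneg z) (norm_nonneg q) hq

theorem summable_norm_evenWeight {q : ℂ} (hq : ‖q‖ < 1) (z : ℂ) :
    Summable fun j => ‖evenWeight q z j‖ := by
  refine (summable_norm_parityWeight hq z).of_nonneg_of_le (fun _ => norm_nonneg _) fun j => ?_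
  simp only [evenWeight, parityWeight, norm_mul, norm_pow]
  gcongr ?_ * ?_
  exact pow_le_pow_of_le_one (norm_nonneg q) hq.le (Nat.choose_le_choose 2 (by omega))

theorem tendsto_sum_cTerm {q : ℂ} (hq : ‖q‖ < 1) (z : ℂ) (s : ℕ)
    (hfin : ∀ n, {μ ∈ lengthLE (s + 1) | cTerm (s + 1) n q z μ ≠ 0}.Finite) :
    Summable (fun μ : lengthLE (s + 1) => cLimTerm (s + 1) q z μ) ∧
      Tendsto (fun n => ∑ᶠ μ ∈ lengthLE (s + 1), cTerm (s + 1) n q z μ) atTop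
        (𝓝 (∑' μ : lengthLE (s + 1), cLimTerm (s + 1) q z μ)) := by
  obtain ⟨C, hC⟩ := exists_norm_poch_inv_le (norm_sq_lt_one hq)
    (one_sub_mul_pow_self_ne_zero (norm_sq_lt_one hq))
  obtain ⟨C', hC'⟩ := exists_norm_poch_inv_le hq (one_sub_mul_pow_self_ne_zero hq)
  exact tendsto_finsum_weight hq (κ := evenStep q) (v := evenInit q) (fun j => hC j)
    (fun j => hC' (2 * j)) (summable_norm_evenWeight hq z) s (fun m => 2 * m)
    (fun n μ hμ => cTerm_eq hμ (poch_self_ne_zero hq n)) (fun μ hμ => cLimTerm_eq hμ) hfin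

theorem tendsto_sum_dTerm {q : ℂ} (hq : ‖q‖ < 1) (z : ℂ) (s : ℕ)
    (hfin : ∀ n, {μ ∈ lengthLE (s + 1) | dTerm (s + 1) n q z μ ≠ 0}.Finite) :
    Summable (fun μ : lengthLE (s + 1) => dLimTerm (s + 1) q z μ) ∧
      Tendsto (fun n => ∑ᶠ μ ∈ lengthLE (s + 1), dTerm (s + 1) n q z μ) atTop
        (𝓝 (∑' μ : lengthLE (s + 1), dLimTerm (s + 1) q z μ)) := by
  obtain ⟨C, hC⟩ := exists_norm_poch_inv_le (norm_sq_lt_one hq)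
    (one_sub_mul_pow_self_ne_zero (norm_sq_lt_one hq))
  obtain ⟨C', hC'⟩ := exists_norm_poch_inv_le hq (one_sub_mul_pow_self_ne_zero hq)
  exact tendsto_finsum_weight hq (κ := parityStep q) (v := parityInit q) (fun j => hC (j / 2))
    (fun j => hC' j) (summable_norm_parityWeight hq z) s (fun m => m)
    (fun n μ hμ => dTerm_eq hμ (poch_self_ne_zero hq n)) (fun μ hμ => dLimTerm_eq hμ) hfin

theorem sum_range_eq_tsum {n : ℕ} {F : ℕ → ℂ} (hF : ∀ r, n < r → F r = 0) :
    ∑ r ∈ Finset.range (n + 1), F r = ∑' r, F r :=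
  (tsum_eq_sum fun r hr => hF r (by simpa using hr)).symm

theorem tendsto_qBinom {q : ℂ} (hq : ‖q‖ < 1) (r : ℕ) :
    Tendsto (fun n => qBinom q n r) atTop (𝓝 (poch q q r)⁻¹) := by
  simp only [qBinom_eq]
  have := (tendsto_poch_mul_recipPoch hq r).mul_const (poch q q r)⁻¹
  rwa [one_mul] at this

theorem exists_norm_qBinom_le {q : ℂ} (hq : ‖q‖ < 1) :
    ∃ C, 0 ≤ C ∧ ∀ n r, ‖qBinom q n r‖ ≤ C := by
  obtain ⟨B, hB0, hB⟩ := exists_norm_poch_mul_recipPoch_le hq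
  obtain ⟨C, hC⟩ := exists_norm_poch_inv_le hq (one_sub_mul_pow_self_ne_zero hq)
  have h0 : 0 ≤ C := (norm_nonneg _).trans (hC 0)
  refine ⟨B * C, by positivity, fun n r => ?_⟩
  rw [qBinom_eq, norm_mul]
  exact mul_le_mul (hB _ _) (hC r) (norm_nonneg _) hB0

/-- Writing 1/(a q^r)_n as (a)_r/(a)_{r+n} bounds it uniformly in both r and n, as domination of the
closed form requires. -/
theorem exists_norm_shifted_poch_inv_le {q a : ℂ} (hq : ‖q‖ < 1)
    (ha : ∀ i : ℕ, 1 - a * q ^ i ≠ 0) :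
    ∃ C, 0 ≤ C ∧ ∀ r n, ‖(poch (a * q ^ r) q n)⁻¹‖ ≤ C := by
  obtain ⟨B, hB⟩ := exists_norm_poch_le hq a
  obtain ⟨C, hC⟩ := exists_norm_poch_inv_le hq ha
  have h0 : 0 ≤ C := (norm_nonneg _).trans (hC 0)
  have h0' : 0 ≤ B := (norm_nonneg _).trans (hB 0)
  refine ⟨B * C, by positivity, fun r n => ?_⟩
  have h1 : poch a q r ≠ 0 := poch_ne_zero_iff.2 fun i _ => ha i
  have : (poch (a * q ^ r) q n)⁻¹ = poch a q r * (poch a q (r + n))⁻¹ := by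
    rw [poch_add, mul_inv, mul_inv_cancel_left₀ h1]
  rw [this, norm_mul]
  exact mul_le_mul (hB r) (hC _) (norm_nonneg _) h0'

theorem norm_one_sub_mul_pow_le {q : ℂ} (hq : ‖q‖ < 1) (a : ℂ) (i : ℕ) :
    ‖1 - a * q ^ i‖ ≤ 1 + ‖a‖ := by
  refine (norm_sub_le _ _).trans ?_
  rw [norm_one, norm_mul, norm_pow]
  have := pow_le_one₀ (n := i) (norm_nonneg q) hq.le
  have := mul_le_of_le_one_right (norm_nonneg a) this
  linarith

theorem exists_norm_one_sub_inv_le {q a : ℂ} (hq : ‖q‖ < 1)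
    (ha : ∀ i : ℕ, 1 - a * q ^ i ≠ 0) :
    ∃ C, 0 ≤ C ∧ ∀ r : ℕ, ‖(1 - a * q ^ r)⁻¹‖ ≤ C := by
  obtain ⟨C, h0, hC⟩ := exists_norm_shifted_poch_inv_le hq ha
  refine ⟨C, h0, fun r => ?_⟩
  simpa [poch] using hC r 1

theorem summable_norm_closed {q : ℂ} (hq : ‖q‖ < 1) (z : ℂ) (k : ℕ) {e : ℕ → ℕ}
    (he : ∀ r, r.choose 2 ≤ e r) : Summable fun r => ‖z ^ (k * r) * q ^ e r‖ := by
  refine (summable_norm_parityWeight hq (z ^ k)).of_nonneg_of_le (fun _ => norm_nonneg _)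
    fun r => ?_
  simp only [parityWeight, norm_mul, norm_pow, pow_mul]
  gcongr ?_ * ?_
  exact pow_le_pow_of_le_one (norm_nonneg q) hq.le (he r)

theorem tendsto_cClosed {q z : ℂ} (hq0 : q ≠ 0) (hq : ‖q‖ < 1)
    (hz : ∀ m : ℕ, z * q ^ ((m : ℤ) - 1) ≠ 1) (k : ℕ) :
    Summable (cLimClosedTerm k q z) ∧
      Tendsto (fun n => cClosed k n q z) atTop
        (𝓝 (pochInf z (q ^ 2) * ∑' r, cLimClosedTerm k q z r)) := by
  obtain ⟨t, rfl⟩ : ∃ t, z = t * q := ⟨z / q, by field_simp⟩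
  have ez : ∀ r : ℕ, t * q * q ^ ((r : ℤ) - 1) = t * q ^ r := fun r => by
    rw [mul_assoc, ← zpow_one_add₀ hq0, show 1 + ((r : ℤ) - 1) = (r : ℤ) by ring, zpow_natCast]
  have ez2 : ∀ r : ℕ, t * q * q ^ (2 * (r : ℤ) - 1) = t * q ^ (2 * r) := fun r => by
    have := ez (2 * r); push_cast at this; exact this
  have ez4 : ∀ r : ℕ, t * q * q ^ (4 * (r : ℤ) - 1) = t * q ^ (4 * r) := fun r => by
    have := ez (4 * r); push_cast at this; exact this
  have ht : ∀ i : ℕ, 1 - t * q ^ i ≠ 0 := fun i => by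
    rw [← ez, sub_ne_zero]; exact (hz i).symm
  obtain ⟨B, hB0, hB⟩ := exists_norm_qBinom_le hq
  obtain ⟨C, hC0, hC⟩ := exists_norm_shifted_poch_inv_le hq ht
  have key := summable_tendsto_tsum_of_norm_le
    (f := fun n r => (t * q) ^ (k * r) * q ^ ((k + 1) * (2 * r).choose 2) * qBinom q n (2 * r) *
      ((1 - t * q ^ (4 * r)) / poch (t * q ^ (2 * r)) q (n + 1)))
    (g := cLimClosedTerm k q (t * q))
    (bound := fun r => ‖(t * q) ^ (k * r) * q ^ ((k + 1) * (2 * r).choose 2)‖ *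
      (B * ((1 + ‖t‖) * C)))
    ((summable_norm_closed hq _ k fun r => ?_).mul_right _) ?_ ?_
  · refine ⟨key.1, ?_⟩
    convert (tendsto_poch (norm_sq_lt_one hq) (t * q)).mul key.2 using 2 with n
    rw [cClosed]
    simp only [ez2, ez4]
    rw [sum_range_eq_tsum]
    intro r hr
    rw [qBinom_eq, recipPoch_of_lt _ (by omega)]
    ring
  · calc r.choose 2 ≤ (2 * r).choose 2 := Nat.choose_le_choose 2 (by omega)
      _ ≤ (k + 1) * (2 * r).choose 2 := Nat.le_mul_of_pos_left _ (by omega)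
  · intro r
    have h0 : pochInf (t * q ^ (2 * r)) q ≠ 0 := pochInf_ne_zero hq fun i => by
      rw [mul_assoc, ← pow_add]; exact ht _
    have h1 := ((tendsto_poch hq (t * q ^ (2 * r))).comp (tendsto_add_atTop_nat 1))
    have h2 := ((tendsto_qBinom hq (2 * r)).const_mul
      ((t * q) ^ (k * r) * q ^ ((k + 1) * (2 * r).choose 2))).mul
      ((tendsto_const_nhds (x := 1 - t * q ^ (4 * r))).div h1 h0)
    have e : cLimClosedTerm k q (t * q) r =
        (t * q) ^ (k * r) * q ^ ((k + 1) * (2 * r).choose 2) * (poch q q (2 * r))⁻¹ *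
          ((1 - t * q ^ (4 * r)) / pochInf (t * q ^ (2 * r)) q) := by
      rw [cLimClosedTerm, ez2, ez4]
      simp only [div_eq_mul_inv, mul_inv]
      ring
    rw [e]
    exact h2
  · intro n r
    rw [mul_assoc _ (qBinom _ _ _), norm_mul (_ ^ _ * _ ^ _), norm_mul (qBinom _ _ _),
      div_eq_mul_inv, norm_mul (1 - _)]
    refine mul_le_mul_of_nonneg_left ?_ (norm_nonneg _)
    refine mul_le_mul (hB _ _) ?_ (by positivity) hB0
    exact mul_le_mul (norm_one_sub_mul_pow_le hq _ _) (hC _ _) (norm_nonneg _) (by positivity)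

theorem tendsto_dClosed {q z : ℂ} (hq0 : q ≠ 0) (hq : ‖q‖ < 1)
    (hz : ∀ m : ℕ, z * q ^ ((m : ℤ) - 1) ≠ 1) (hz2 : ∀ m : ℕ, z ^ 2 * q ^ ((m : ℤ) - 1) ≠ 1)
    (k : ℕ) :
    Summable (dLimClosedTerm k q z) ∧
      Tendsto (fun n => dClosed k n q z) atTop
        (𝓝 (pochInf (z ^ 2) (q ^ 2) * ∑' r, dLimClosedTerm k q z r)) := by
  obtain ⟨t, rfl⟩ : ∃ t, z = t * q := ⟨z / q, by field_simp⟩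
  have ez : ∀ r : ℕ, t * q * q ^ ((r : ℤ) - 1) = t * q ^ r := fun r => by
    rw [mul_assoc, ← zpow_one_add₀ hq0, show 1 + ((r : ℤ) - 1) = (r : ℤ) by ring, zpow_natCast]
  have ez0 : t * q * q ^ (-1 : ℤ) = t := by
    have := ez 0; simpa using this
  have ez1 : ∀ r : ℕ, (t * q) ^ 2 * q ^ ((r : ℤ) - 1) = t ^ 2 * q * q ^ r := fun r => by
    rw [sq (t * q), mul_assoc, ez]
    ring
  have ez2 : ∀ r : ℕ, (t * q) ^ 2 * q ^ (2 * (r : ℤ) - 1) = t ^ 2 * q * q ^ (2 * r) := fun r => by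
    have := ez1 (2 * r); push_cast at this; exact this
  have ez3 : ∀ r : ℕ, t * q * q ^ r = t * q ^ (r + 1) := fun r => by ring
  have ht : ∀ i : ℕ, 1 - t * q ^ i ≠ 0 := fun i => by
    rw [← ez, sub_ne_zero]; exact (hz i).symm
  have ht2 : ∀ i : ℕ, 1 - t ^ 2 * q * q ^ i ≠ 0 := fun i => by
    rw [← ez1, sub_ne_zero]; exact (hz2 i).symm
  obtain ⟨B, hB0, hB⟩ := exists_norm_qBinom_le hq
  obtain ⟨C, hC0, hC⟩ := exists_norm_shifted_poch_inv_le hq ht2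
  obtain ⟨E, hE0, hE⟩ := exists_norm_one_sub_inv_le hq ht
  have key := summable_tendsto_tsum_of_norm_le
    (f := fun n r => (t * q) ^ (k * r) * q ^ (r + (k + 1) * r.choose 2) * qBinom q n r *
      (((1 - t) * (1 - t ^ 2 * q * q ^ (2 * r)) * (1 - t * q ^ (n + 1))) /
        ((1 - t * q ^ r) * (1 - t * q ^ (r + 1)) * poch (t ^ 2 * q * q ^ r) q (n + 1))))
    (g := dLimClosedTerm k q (t * q))
    (bound := fun r => ‖(t * q) ^ (k * r) * q ^ (r + (k + 1) * r.choose 2)‖ *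
      (B * ((‖1 - t‖ * (1 + ‖t ^ 2 * q‖) * (1 + ‖t‖)) * (E * E * C))))
    ((summable_norm_closed hq _ k fun r => ?_).mul_right _) ?_ ?_
  · refine ⟨key.1, ?_⟩
    convert (tendsto_poch (norm_sq_lt_one hq) ((t * q) ^ 2)).mul key.2 using 2 with n
    rw [dClosed]
    simp only [ez, ez0, ez1, ez2, ez3]
    rw [sum_range_eq_tsum]
    intro r hr
    rw [qBinom_eq, recipPoch_of_lt _ (by omega)]
    ring
  · exact (Nat.le_mul_of_pos_left _ (by omega : 0 < k + 1)).trans (Nat.le_add_left _ _)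
  · intro r
    have h0 : pochInf (t ^ 2 * q * q ^ r) q ≠ 0 := pochInf_ne_zero hq fun i => by
      rw [mul_assoc, ← pow_add]; exact ht2 _
    have h1 := ((tendsto_poch hq (t ^ 2 * q * q ^ r)).comp (tendsto_add_atTop_nat 1)).const_mul
      ((1 - t * q ^ r) * (1 - t * q ^ (r + 1)))
    have h3 : Tendsto (fun n : ℕ => 1 - t * q ^ (n + 1)) atTop (𝓝 (1 - t * 0)) :=
      (((tendsto_pow_atTop_nhds_zero_of_norm_lt_one hq).comp
        (tendsto_add_atTop_nat 1)).const_mul t).const_sub 1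
    have h2 := ((tendsto_qBinom hq r).const_mul
      ((t * q) ^ (k * r) * q ^ (r + (k + 1) * r.choose 2))).mul
      ((h3.const_mul ((1 - t) * (1 - t ^ 2 * q * q ^ (2 * r)))).div h1
        (mul_ne_zero (mul_ne_zero (ht _) (ht _)) h0))
    have e : dLimClosedTerm k q (t * q) r =
        (t * q) ^ (k * r) * q ^ (r + (k + 1) * r.choose 2) * (poch q q r)⁻¹ *
          ((1 - t) * (1 - t ^ 2 * q * q ^ (2 * r)) * (1 - t * 0) /
            ((1 - t * q ^ r) * (1 - t * q ^ (r + 1)) * pochInf (t ^ 2 * q * q ^ r) q)) := by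
      rw [dLimClosedTerm, ez0, ez, ez1, ez2, ez3]
      simp only [div_eq_mul_inv, mul_inv, mul_zero, sub_zero, mul_one]
      ring
    rw [e]
    exact h2
  · intro n r
    rw [mul_assoc _ (qBinom _ _ _), norm_mul (_ ^ _ * _ ^ _), norm_mul (qBinom _ _ _),
      div_eq_mul_inv, norm_mul (_ * _ * _), norm_mul (_ * _), norm_mul (1 - _), mul_inv, mul_inv,
      norm_mul (_ * _), norm_mul (_⁻¹)]
    refine mul_le_mul_of_nonneg_left ?_ (norm_nonneg _)
    refine mul_le_mul (hB _ _) ?_ (by positivity) hB0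
    have b1 := norm_one_sub_mul_pow_le hq (t ^ 2 * q) (2 * r)
    have b2 := norm_one_sub_mul_pow_le hq t (n + 1)
    have b3 := hE r
    have b4 := hE (r + 1)
    have b5 := hC r (n + 1)
    gcongr

end Limits

end QPart

/-! ### Assembly of the theorem -/

theorem theorem4 (k : ℕ) (hk : 1 ≤ k) :
    -- the finite identity with the coefficients `c`
    (∀ (K : Type u) [Field K] (n : ℕ) (q z : K), q ≠ 0 → QPart.poch q q n ≠ 0 →
      (∀ r : ℕ, 2 * r ≤ n → QPart.poch (z * q ^ (2 * (r : ℤ) - 1)) q (n + 1) ≠ 0) →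
      {μ ∈ QPart.lengthLE k | QPart.cTerm k n q z μ ≠ 0}.Finite ∧
      ∑ᶠ μ ∈ QPart.lengthLE k, QPart.cTerm k n q z μ = QPart.cClosed k n q z) ∧
    -- the finite identity with the coefficients `d`
    (∀ (K : Type u) [Field K] (n : ℕ) (q z : K), q ≠ 0 → QPart.poch q q n ≠ 0 →
      (∀ r : ℕ, r ≤ n → (1 - z * q ^ ((r : ℤ) - 1)) * (1 - z * q ^ r) *
        QPart.poch (z ^ 2 * q ^ ((r : ℤ) - 1)) q (n + 1) ≠ 0) →
      {μ ∈ QPart.lengthLE k | QPart.dTerm k n q z μ ≠ 0}.Finite ∧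
      ∑ᶠ μ ∈ QPart.lengthLE k, QPart.dTerm k n q z μ = QPart.dClosed k n q z) ∧
    -- the limit `n → ∞` of the first identity
    (∀ q z : ℂ, q ≠ 0 → ‖q‖ < 1 → (∀ m : ℕ, z * q ^ ((m : ℤ) - 1) ≠ 1) →
      Summable (fun μ : QPart.lengthLE k => QPart.cLimTerm k q z μ) ∧
      Summable (QPart.cLimClosedTerm k q z) ∧
      Tendsto (fun n : ℕ => ∑ᶠ μ ∈ QPart.lengthLE k, QPart.cTerm k n q z μ) atTop
        (𝓝 (∑' μ : QPart.lengthLE k, QPart.cLimTerm k q z μ)) ∧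
      Tendsto (fun n : ℕ => QPart.cClosed k n q z) atTop
        (𝓝 (QPart.pochInf z (q ^ 2) * ∑' r : ℕ, QPart.cLimClosedTerm k q z r)) ∧
      ∑' μ : QPart.lengthLE k, QPart.cLimTerm k q z μ =
        QPart.pochInf z (q ^ 2) * ∑' r : ℕ, QPart.cLimClosedTerm k q z r) ∧
    -- the limit `n → ∞` of the second identity
    (∀ q z : ℂ, q ≠ 0 → ‖q‖ < 1 → (∀ m : ℕ, z * q ^ ((m : ℤ) - 1) ≠ 1) →
      (∀ m : ℕ, z ^ 2 * q ^ ((m : ℤ) - 1) ≠ 1) →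
      Summable (fun μ : QPart.lengthLE k => QPart.dLimTerm k q z μ) ∧
      Summable (QPart.dLimClosedTerm k q z) ∧
      Tendsto (fun n : ℕ => ∑ᶠ μ ∈ QPart.lengthLE k, QPart.dTerm k n q z μ) atTop
        (𝓝 (∑' μ : QPart.lengthLE k, QPart.dLimTerm k q z μ)) ∧
      Tendsto (fun n : ℕ => QPart.dClosed k n q z) atTop
        (𝓝 (QPart.pochInf (z ^ 2) (q ^ 2) * ∑' r : ℕ, QPart.dLimClosedTerm k q z r)) ∧
      ∑' μ : QPart.lengthLE k, QPart.dLimTerm k q z μ =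
        QPart.pochInf (z ^ 2) (q ^ 2) * ∑' r : ℕ, QPart.dLimClosedTerm k q z r) := by
  obtain ⟨s, rfl⟩ : ∃ s, k = s + 1 := ⟨k - 1, by omega⟩
  refine ⟨fun K _ n q z hq0 hq hz => QPart.sum_cTerm s n hq0 hq hz,
    fun K _ n q z hq0 hq hz => QPart.sum_dTerm s n hq0 hq hz, fun q z hq0 hq hz => ?_,
    fun q z hq0 hq hz hz2 => ?_⟩
  · have hfin : ∀ n, _ := fun n =>
      QPart.sum_cTerm s n hq0 (QPart.poch_self_ne_zero hq n) (z := z) fun r _ => by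
        -- The i-th factor of the r-th denominator is 1 - z q^{2r+i-1}, so the hypothesis on z is
        -- used at m = 2r + i.
        refine QPart.poch_ne_zero_iff.2 fun i _ => sub_ne_zero.2 fun h => hz (2 * r + i) ?_
        rw [h, mul_assoc, ← zpow_natCast q i, ← zpow_add₀ hq0]
        congr 2
        push_cast
        ring
    obtain ⟨h1, h2⟩ := QPart.tendsto_sum_cTerm hq z s fun n => (hfin n).1
    obtain ⟨h3, h4⟩ := QPart.tendsto_cClosed hq0 hq hz (s + 1)
    -- The finite identity holds for every n, so both limits are limits of one sequence.
    exact ⟨h1, h3, h2, h4, tendsto_nhds_unique h2 (h4.congr fun n => (hfin n).2.symm)⟩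
  · have hfin : ∀ n, _ := fun n =>
      QPart.sum_dTerm s n hq0 (QPart.poch_self_ne_zero hq n) (z := z) fun r _ => by
        refine mul_ne_zero (mul_ne_zero (sub_ne_zero.2 (hz r).symm) (sub_ne_zero.2 fun h => ?_)) ?_
        · refine hz (r + 1) ?_
          rw [h, ← zpow_natCast q r]
          congr 2
          push_cast
          ring
        · refine QPart.poch_ne_zero_iff.2 fun i _ => sub_ne_zero.2 fun h => hz2 (r + i) ?_
          rw [h, mul_assoc, ← zpow_natCast q i, ← zpow_add₀ hq0]
          congr 2
          push_cast
          ring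
    obtain ⟨h1, h2⟩ := QPart.tendsto_sum_dTerm hq z s fun n => (hfin n).1
    obtain ⟨h3, h4⟩ := QPart.tendsto_dClosed hq0 hq hz hz2 (s + 1)
    exact ⟨h1, h3, h2, h4, tendsto_nhds_unique h2 (h4.congr fun n => (hfin n).2.symm)⟩
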